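/- **Setting.** For each $n\ge1$ let $X$ be an $n\times p$ real design matrix, $p=p_n$, which is either deterministic or random and independent of the error vector $\epsilon\sim N(0,\sigma_0^2I_n)$, $\sigma_0>0$. A model is a subset $\gamma\subseteq\{1,\dots,p\}$; $X_\gamma$ denotes the submatrix of the columns of $X$ with index in $\gamma$. Consider the hierarchical Bayesian model $$\mathbf y\mid\beta,\sigma^2\sim N(X\beta,\sigma^2I_n),\qquad \beta_j\mid\gamma,\sigma^2\sim\begin{cases}N(0,c_j\sigma^2)& j\in\gamma\\ \delta_0& j\notin\gamma\end{cases}\ \text{(independently over } j),\qquad 1/\sigma^2\sim\chi^2_\nu,\qquad \gamma\sim p(\gamma),$$ where $\nu>0$ is fixed, $c_1,\dots,c_p>0$ are hyperparameters, $\delta_0$ is here the point mass at $0$, and $p(\cdot)$ is a probability distribution on the models, which may depend on $n$. Let $p(\gamma\mid Z)$ be the resulting posterior probability of $\gamma$ given $Z=(\mathbf y,X)$. **Theorem.** Suppose that the true model is the null model $\emptyset$, i.e. the data are $\mathbf y=\epsilon$, and that: 1. there is a constant $C_0>0$ with $\max_\gamma p(\gamma)/p(\emptyset)\le C_0$ for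 all $n$; 2. $p\to\infty$, $p\le n$ for all $n$, and $p\log p=o(n)$ as $n\to\infty$; 3. $0<\underline\phi_n\le\bar\phi_n$ for all $n$, and $\bar\phi_n=O(n^{\kappa})$ for some constant $\kappa>0$; 4. there are constants $C_3>0$ and $\delta\ge0$ such that $n^{1-\delta}\underline\phi_n\to\infty$ and, for every $n$, almost surely $$\lambda_{\min}\!\left(\tfrac1nX_\gamma^TX_\gamma\right)\ge C_3n^{-\delta}\qquad\text{for all }\gamma\ne\emptyset .$$ Let $\delta$ be as in 4. Then, as $n\to\infty$: * if $p^{\alpha_0}=o(n^{1-\delta}\underline\phi_n)$ for some $\alpha_0>2$, then $$\sup_{c_1,\dots,c_p\in[\underline\phi_n,\bar\phi_n]}\ \max_{\gamma\ne\emptyset}\frac{p(\gamma\mid Z)}{p(\emptyset\mid Z)}\to0\quad\text{in probability};$$ * if $p^{\alpha_0+2}=o(n^{1-\delta}\underline\phi_n)$ for some $\alpha_0>2$, then $$\sup_{c_1,\dots,c_p\in[\underline\phi_n,\bar\phi_n]}\ \sum_{\gamma\ne\emptyset}p(\gamma\mid Z)\to0\quad\text{and}\quad\inf_{c_1,\dots,c_p\in[\underline\phi_n,\bar\phi_n]}p(\emptyset\mid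 Z)\to1\quad\text{in probability}.$$ -/

import Mathlib

open MeasureTheory ProbabilityTheory Filter Asymptotics
open scoped Topology ENNReal NNReal

namespace BayesSelection

noncomputable section

/-! A model (state vector) on `p` covariates is the set `γ : Finset (Fin p)` of the indices of its
nonzero coordinates; the null model is `∅`. -/

/-- The submatrix `X_s` of the columns of `X` indexed by `s`. -/
def cols {n p : ℕ} (X : Matrix (Fin n) (Fin p) ℝ) (s : Finset (Fin p)) :
    Matrix (Fin n) {j // j ∈ s} ℝ :=
  X.submatrix id Subtype.val

/-- `P_γ = X_γ (X_γᵀ X_γ)⁻¹ X_γᵀ`; this is `0` for `γ = ∅`. -/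
def projMatrix {n p : ℕ} (X : Matrix (Fin n) (Fin p) ℝ) (γ : Finset (Fin p)) :
    Matrix (Fin n) (Fin n) ℝ :=
  cols X γ * ((cols X γ).transpose * cols X γ)⁻¹ * (cols X γ).transpose

/-- The minimal (real) eigenvalue of a square matrix. It is used only for symmetric matrices of
positive size, whose spectrum is a nonempty finite set of reals. -/
def minEigenvalue {ι : Type*} [Fintype ι] [DecidableEq ι] (A : Matrix ι ι ℝ) : ℝ :=
  sInf (spectrum ℝ A)

/-- `n⁻¹ X_{γ∖γ₀}ᵀ (I - P_{γ₀}) X_{γ∖γ₀}`. -/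
def residualGram {n p : ℕ} (X : Matrix (Fin n) (Fin p) ℝ) (γ₀ γ : Finset (Fin p)) :
    Matrix {j // j ∈ γ \ γ₀} {j // j ∈ γ \ γ₀} ℝ :=
  (1 / (n : ℝ)) •
    ((cols X (γ \ γ₀)).transpose * (1 - projMatrix X γ₀) * cols X (γ \ γ₀))

/-- The chi-square distribution with `ν` degrees of freedom. -/
def chiSquare (ν : ℝ) : Measure ℝ := gammaMeasure (ν / 2) (1 / 2)

/-- The density at `y` of `N(X β, σ² I_n)`, with `v = σ²`. -/
def likelihood {n p : ℕ} (X : Matrix (Fin n) (Fin p) ℝ) (β : Fin p → ℝ) (v : ℝ)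
    (y : Fin n → ℝ) : ℝ≥0∞ :=
  ∏ i, gaussianPDF (X.mulVec β i) v.toNNReal (y i)

/-- The conditional prior of `β` given `γ` and `v = σ²`: the coordinates are independent, with
law `N(0, c_j σ²)` for `j ∈ γ` and a point mass at `0` for `j ∉ γ`. -/
def coefPrior {p : ℕ} (c : Fin p → ℝ) (γ : Finset (Fin p)) (v : ℝ) : Measure (Fin p → ℝ) :=
  Measure.pi fun j => if j ∈ γ then gaussianReal 0 (c j * v).toNNReal else Measure.dirac 0

/-- The marginal density of `y` under the model `γ`: the likelihood with `β` and `σ²` integrated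
out, where `τ = 1 / σ²` has a chi-square law with `ν` degrees of freedom. -/
def marginal {n p : ℕ} (ν : ℝ) (c : Fin p → ℝ) (X : Matrix (Fin n) (Fin p) ℝ)
    (y : Fin n → ℝ) (γ : Finset (Fin p)) : ℝ≥0∞ :=
  ∫⁻ τ, ∫⁻ β, likelihood X β τ⁻¹ y ∂(coefPrior c γ τ⁻¹) ∂(chiSquare ν)

/-- The posterior probability `p(γ | Z)`, `Z = (y, X)`, for the prior `π` on models. -/
def posterior {n p : ℕ} (π : PMF (Finset (Fin p))) (ν : ℝ) (c : Fin p → ℝ)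
    (X : Matrix (Fin n) (Fin p) ℝ) (y : Fin n → ℝ) (γ : Finset (Fin p)) : ℝ≥0∞ :=
  π γ * marginal ν c X y γ / ∑ γ', π γ' * marginal ν c X y γ'

/-- The hyperparameters `c` with `c_1, …, c_p ∈ [a, b]`. -/
def hyperBox (p : ℕ) (a b : ℝ) : Set (Fin p → ℝ) := {c | ∀ j, c j ∈ Set.Icc a b}

/-- `sup_c max_{γ ≠ γ₀} p(γ | Z) / p(γ₀ | Z)`. -/
def supOdds {n p : ℕ} (π : PMF (Finset (Fin p))) (ν a b : ℝ) (γ₀ : Finset (Fin p))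
    (X : Matrix (Fin n) (Fin p) ℝ) (y : Fin n → ℝ) : ℝ≥0∞ :=
  ⨆ c ∈ hyperBox p a b, ⨆ γ : Finset (Fin p), ⨆ _ : γ ≠ γ₀,
    posterior π ν c X y γ / posterior π ν c X y γ₀

/-- `sup_c ∑_{γ ≠ γ₀} p(γ | Z)`. -/
def supWrong {n p : ℕ} (π : PMF (Finset (Fin p))) (ν a b : ℝ) (γ₀ : Finset (Fin p))
    (X : Matrix (Fin n) (Fin p) ℝ) (y : Fin n → ℝ) : ℝ≥0∞ :=
  ⨆ c ∈ hyperBox p a b, ∑ γ ∈ Finset.univ.erase γ₀, posterior π ν c X y γ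

/-- `inf_c p(γ₀ | Z)`. -/
def infTrue {n p : ℕ} (π : PMF (Finset (Fin p))) (ν a b : ℝ) (γ₀ : Finset (Fin p))
    (X : Matrix (Fin n) (Fin p) ℝ) (y : Fin n → ℝ) : ℝ≥0∞ :=
  ⨅ c ∈ hyperBox p a b, posterior π ν c X y γ₀

end

end BayesSelection

/-! Integrating out `β` and `σ²` turns the comparison of `γ` with `∅` into a comparison of residual
sums of squares. By `marginal_le`, completing the square costs `γ` a factor `(r a)^(-|γ|/2)`, where
`r = C₃ n^(1-δ)` bounds the Gram matrix from below and `a = φlow n`. By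
`exists_precisionIntegral_eq`, the precision integral is `K (1 + RSS)^(-(n+ν)/2)`, and `K` cancels
in the odds. The bounds see `c` only through its lower endpoint, hence are uniform in `c`.

The gain from fitting noise is at most `exp((n+ν)/2 · yᵀP_γ y / (1 + RSS))`. A Chernoff bound for
projected Gaussian noise and a union bound (`measure_exists_fittedSS_gt_le`) give `yᵀP_γ y ≤
2(1+η)σ₀²|γ| log p` for all `γ` at once, with probability tending to one. Likewise `|y|² ≥
(1-η)nσ₀²`, and `p log p = o(n)` then keeps the RSS above `(1-2η)nσ₀²`. So the gain is at most
`p^(q|γ|)` for any fixed `q > 1`, and the odds are at most `C₀ x^|γ|` with `x = p^q / √(C₃ n^(1-δ)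
φlow)` (`exists_exceptional_odds_le`).

With `q = α₀/2`, the first rate gives `x → 0`, which controls the maximum; the second gives `p x →
0`, which controls the sum `C₀((1+x)^p - 1)`. -/

namespace BayesSelection

/-! ### Least squares, projections and the smallest eigenvalue. -/

section LinearAlgebra

open Matrix

variable {m ι : Type*} [Fintype m] [Fintype ι] [DecidableEq ι]

/-- Completing the square in the least squares criterion. -/
lemma exists_leastSquares_decomposition (A : Matrix m ι ℝ) (hA : IsUnit (Aᵀ * A).det) (y : m → ℝ) :
    ∃ b : ι → ℝ, ∀ w : ι → ℝ, (y - A *ᵥ w) ⬝ᵥ (y - A *ᵥ w) =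
      (y ⬝ᵥ y - y ⬝ᵥ ((A * (Aᵀ * A)⁻¹ * Aᵀ) *ᵥ y)) + (A *ᵥ (w - b)) ⬝ᵥ (A *ᵥ (w - b)) := by
  set b : ι → ℝ := (Aᵀ * A)⁻¹ *ᵥ (Aᵀ *ᵥ y) with hb
  have hAb : (A * (Aᵀ * A)⁻¹ * Aᵀ) *ᵥ y = A *ᵥ b := by
    simp [hb, mulVec_mulVec, Matrix.mul_assoc]
  have hr : Aᵀ *ᵥ (y - A *ᵥ b) = 0 := by
    rw [mulVec_sub, hb, mulVec_mulVec, mulVec_mulVec, mul_nonsing_inv _ hA, one_mulVec, sub_self]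
  have hort : ∀ u : ι → ℝ, (y - A *ᵥ b) ⬝ᵥ (A *ᵥ u) = 0 := fun u => by
    rw [dotProduct_mulVec, ← mulVec_transpose, hr, zero_dotProduct]
  refine ⟨b, fun w => ?_⟩
  have h1 : y - A *ᵥ w = (y - A *ᵥ b) - A *ᵥ (w - b) := by
    rw [mulVec_sub]; abel
  have h2 : (y - A *ᵥ b) ⬝ᵥ (y - A *ᵥ b) = y ⬝ᵥ y - y ⬝ᵥ (A *ᵥ b) := by
    conv_lhs => rw [dotProduct_sub, hort, sub_zero, sub_dotProduct]
    rw [dotProduct_comm (A *ᵥ b) y]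
  rw [hAb, h1, sub_dotProduct, dotProduct_sub _ _ (A *ᵥ (w - b)), hort,
    dotProduct_sub (A *ᵥ (w - b)), dotProduct_comm (A *ᵥ (w - b)) (y - A *ᵥ b), hort, h2]
  ring

/-- The orthogonal projection onto the column space factors through an isometry. -/
lemma exists_isometry_factor (A : Matrix m ι ℝ) (hA : IsUnit (Aᵀ * A).det) :
    ∃ U : Matrix m ι ℝ, Uᵀ * U = 1 ∧ A * (Aᵀ * A)⁻¹ * Aᵀ = U * Uᵀ := by
  have hps : (Aᵀ * A).PosSemidef := by
    simpa [conjTranspose_eq_transpose_of_trivial] using posSemidef_conjTranspose_mul_self A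
  obtain ⟨B, hB⟩ : ∃ B : Matrix ι ι ℝ, Aᵀ * A = Bᵀ * B := by
    open scoped MatrixOrder in
    obtain ⟨B, hB⟩ := CStarAlgebra.nonneg_iff_eq_star_mul_self.mp hps.nonneg
    exact ⟨B, by simpa [star_eq_conjTranspose, conjTranspose_eq_transpose_of_trivial] using hB⟩
  have hBu : IsUnit B.det := by
    rw [hB, det_mul] at hA
    exact isUnit_of_mul_isUnit_right hA
  -- `Aᵀ A = Bᵀ B`, so multiplying by `B⁻¹` orthonormalizes the columns of `A`.
  refine ⟨A * B⁻¹, ?_, ?_⟩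
  · rw [transpose_mul, transpose_nonsing_inv, Matrix.mul_assoc, ← Matrix.mul_assoc Aᵀ, hB,
      Matrix.mul_assoc, mul_nonsing_inv _ hBu, Matrix.mul_one, nonsing_inv_mul]
    simpa using hBu
  · rw [transpose_mul, transpose_nonsing_inv, hB, Matrix.mul_inv_rev]
    simp [Matrix.mul_assoc]

-- Subtracting `l • 1` shifts the spectrum by `l`, so with `l` the smallest eigenvalue the
-- difference is positive semidefinite.
open scoped Pointwise in
lemma minEigenvalue_mul_le (A : Matrix ι ι ℝ) (hA : A.IsHermitian) (v : ι → ℝ) :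
    minEigenvalue A * (v ⬝ᵥ v) ≤ v ⬝ᵥ (A *ᵥ v) := by
  have hle : ∀ i, minEigenvalue A ≤ hA.eigenvalues i := fun i => by
    rw [minEigenvalue, hA.spectrum_real_eq_range_eigenvalues]
    exact csInf_le (Set.finite_range _).bddBelow ⟨i, rfl⟩
  set l := minEigenvalue A
  have hH : (A - l • 1).IsHermitian :=
    hA.sub (by simp [IsHermitian])
  have hps : (A - l • (1 : Matrix ι ι ℝ)).PosSemidef := by
    rw [hH.posSemidef_iff_eigenvalues_nonneg]
    intro i
    have hi : hH.eigenvalues i ∈ spectrum ℝ (A - l • (1 : Matrix ι ι ℝ)) := by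
      rw [hH.spectrum_real_eq_range_eigenvalues]; exact ⟨i, rfl⟩
    have h2 : hH.eigenvalues i + l ∈ spectrum ℝ A := by
      have hsp : spectrum ℝ (A - l • (1 : Matrix ι ι ℝ)) = spectrum ℝ A - ({l} : Set ℝ) := by
        rw [← Algebra.algebraMap_eq_smul_one, ← spectrum.sub_singleton_eq]
      rw [hsp] at hi
      obtain ⟨a, ha, b, hb, h⟩ := hi
      simp only [Set.mem_singleton_iff] at hb
      rw [← h, hb]
      simpa using ha
    rw [hA.spectrum_real_eq_range_eigenvalues] at h2
    obtain ⟨j, hj⟩ := h2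
    have := hle j
    simp only [Pi.zero_apply]
    linarith
  have := hps.dotProduct_mulVec_nonneg v
  simp only [star_trivial, sub_mulVec, smul_mulVec, one_mulVec, dotProduct_sub,
    dotProduct_smul, smul_eq_mul] at this
  linarith

end LinearAlgebra

/-! ### From the eigenvalue condition to the Gram matrices. -/

section Design

open Matrix

variable {n p : ℕ}

lemma projMatrix_empty (X : Matrix (Fin n) (Fin p) ℝ) : projMatrix X ∅ = 0 := by
  ext i j
  simp [projMatrix, Matrix.mul_apply]

lemma le_gram_of_minEigenvalue (hn : 0 < n) (X : Matrix (Fin n) (Fin p) ℝ)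
    (γ : Finset (Fin p)) {l : ℝ} (h : l ≤ minEigenvalue (residualGram X ∅ γ))
    (v : {j // j ∈ γ} → ℝ) :
    n * l * (v ⬝ᵥ v) ≤ (cols X γ *ᵥ v) ⬝ᵥ (cols X γ *ᵥ v) := by
  -- `residualGram X ∅ γ` is indexed by `γ \ ∅`; the bound is proved on that type and transported to
  -- `γ` at the end.
  have key : ∀ v : {j // j ∈ γ \ ∅} → ℝ,
      n * l * (v ⬝ᵥ v) ≤ (cols X (γ \ ∅) *ᵥ v) ⬝ᵥ (cols X (γ \ ∅) *ᵥ v) := by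
    intro v
    have hn' : (0 : ℝ) < n := by exact_mod_cast hn
    have hH : (residualGram X ∅ γ).IsHermitian := by
      rw [residualGram, projMatrix_empty, sub_zero, Matrix.mul_one]
      refine IsHermitian.ext fun i j => ?_
      simp [Matrix.mul_apply, mul_comm]
    have h1 := minEigenvalue_mul_le _ hH v
    have h2 : v ⬝ᵥ (residualGram X ∅ γ *ᵥ v) =
        (1 / n) * ((cols X (γ \ ∅) *ᵥ v) ⬝ᵥ (cols X (γ \ ∅) *ᵥ v)) := by
      rw [residualGram, projMatrix_empty, sub_zero, Matrix.mul_one, smul_mulVec, dotProduct_smul,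
        smul_eq_mul, ← mulVec_mulVec, dotProduct_mulVec v, vecMul_transpose]
    rw [h2] at h1
    have hv : 0 ≤ v ⬝ᵥ v := Finset.sum_nonneg fun i _ => mul_self_nonneg (v i)
    have h3 : l * (v ⬝ᵥ v) ≤ (1 / n) * ((cols X (γ \ ∅) *ᵥ v) ⬝ᵥ (cols X (γ \ ∅) *ᵥ v)) :=
      (mul_le_mul_of_nonneg_right h hv).trans h1
    calc n * l * (v ⬝ᵥ v) = n * (l * (v ⬝ᵥ v)) := by ring
      _ ≤ n * ((1 / n) * ((cols X (γ \ ∅) *ᵥ v) ⬝ᵥ (cols X (γ \ ∅) *ᵥ v))) := by gcongr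
      _ = _ := by field_simp
  have hs : γ \ ∅ = γ := Finset.sdiff_empty
  rw [hs] at key
  exact key v

/-- The lower bound makes `cols X γ` injective, so its Gram matrix is positive definite. -/
lemma isUnit_det_gram {X : Matrix (Fin n) (Fin p) ℝ} {γ : Finset (Fin p)} {r : ℝ} (hr : 0 < r)
    (h : ∀ v : {j // j ∈ γ} → ℝ, r * (v ⬝ᵥ v) ≤ (cols X γ *ᵥ v) ⬝ᵥ (cols X γ *ᵥ v)) :
    IsUnit ((cols X γ)ᵀ * cols X γ).det := by
  have hinj : Function.Injective (cols X γ).mulVec := by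
    intro u v huv
    have h1 := h (u - v)
    rw [mulVec_sub, sub_eq_zero.mpr huv, zero_dotProduct] at h1
    have h0 : 0 ≤ (u - v) ⬝ᵥ (u - v) := Finset.sum_nonneg fun i _ => mul_self_nonneg _
    have h2 : (u - v) ⬝ᵥ (u - v) = 0 := le_antisymm (nonpos_of_mul_nonpos_right h1 hr) h0
    exact sub_eq_zero.mp (dotProduct_self_eq_zero.mp h2)
  have := (PosDef.conjTranspose_mul_self _ hinj).det_pos
  rw [conjTranspose_eq_transpose_of_trivial] at this
  exact this.ne'.isUnit

end Design

/-! ### One-dimensional and product Gaussian integrals. -/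

section GaussianIntegrals

lemma lintegral_exp_neg_mul_sq_sub {s : ℝ} (hs : 0 < s) (b : ℝ) :
    ∫⁻ x : ℝ, ENNReal.ofReal (Real.exp (-s * (x - b) ^ 2)) = ENNReal.ofReal √(Real.pi / s) := by
  rw [lintegral_sub_right_eq_self (fun x : ℝ => ENNReal.ofReal (Real.exp (-s * x ^ 2))) b,
    ← integral_gaussian s, ofReal_integral_eq_lintegral_ofReal (integrable_exp_neg_mul_sq hs)]
  exact Eventually.of_forall fun x => (Real.exp_pos _).le

/-- A Gaussian law integrates a Gaussian bump to at most what Lebesgue measure, scaled by the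
maximum of the density, does. -/
lemma lintegral_exp_sq_sub_gaussianReal_le {s : ℝ} (hs : 0 < s) {v : ℝ≥0} (hv : v ≠ 0) (b : ℝ) :
    ∫⁻ x, ENNReal.ofReal (Real.exp (-s * (x - b) ^ 2 / 2)) ∂(gaussianReal 0 v) ≤
      ENNReal.ofReal (√(s * v))⁻¹ := by
  have hv' : (0 : ℝ) < v := by positivity
  rw [gaussianReal_of_var_ne_zero _ hv, lintegral_withDensity_eq_lintegral_mul _
    (measurable_gaussianPDF _ _) (by fun_prop)]
  calc _ ≤ ∫⁻ x : ℝ, ENNReal.ofReal (√(2 * Real.pi * v))⁻¹ *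
        ENNReal.ofReal (Real.exp (-(s / 2) * (x - b) ^ 2)) := by
        refine lintegral_mono fun x => ?_
        simp only [Pi.mul_apply]
        gcongr ?_ * ENNReal.ofReal (Real.exp ?_)
        · refine ENNReal.ofReal_le_ofReal ?_
          rw [gaussianPDFReal]
          refine mul_le_of_le_one_right (by positivity) (Real.exp_le_one_iff.mpr ?_)
          exact div_nonpos_of_nonpos_of_nonneg (by simp [sq_nonneg]) (by positivity)
        · exact le_of_eq (by ring)
    _ = ENNReal.ofReal (√(s * v))⁻¹ := by
        rw [lintegral_const_mul _ (by fun_prop), lintegral_exp_neg_mul_sq_sub (by positivity),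
          ← ENNReal.ofReal_mul (by positivity), ← Real.sqrt_inv, ← Real.sqrt_inv,
          ← Real.sqrt_mul (by positivity)]
        congr 2
        field_simp

lemma lintegral_exp_sq_gaussianReal {u : ℝ} (hu : -1 < u) {v : ℝ≥0} (hv : v ≠ 0) :
    ∫⁻ x, ENNReal.ofReal (Real.exp (-u * x ^ 2 / (2 * v))) ∂(gaussianReal 0 v) =
      ENNReal.ofReal (√(1 + u))⁻¹ := by
  have hv' : (0 : ℝ) < v := by positivity
  have hu' : 0 < 1 + u := by linarith
  rw [gaussianReal_of_var_ne_zero _ hv, lintegral_withDensity_eq_lintegral_mul _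
    (measurable_gaussianPDF _ _) (by fun_prop)]
  calc _ = ∫⁻ x : ℝ, ENNReal.ofReal (√(2 * Real.pi * v))⁻¹ *
        ENNReal.ofReal (Real.exp (-((1 + u) / (2 * v)) * (x - 0) ^ 2)) := by
        refine lintegral_congr fun x => ?_
        simp only [Pi.mul_apply, gaussianPDF, gaussianPDFReal]
        rw [ENNReal.ofReal_mul (by positivity), mul_assoc, ← ENNReal.ofReal_mul (Real.exp_pos _).le,
          ← Real.exp_add]
        congr 3
        field_simp
        ring
    _ = ENNReal.ofReal (√(1 + u))⁻¹ := by
        rw [lintegral_const_mul _ (by fun_prop), lintegral_exp_neg_mul_sq_sub (by positivity),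
          ← ENNReal.ofReal_mul (by positivity), ← Real.sqrt_inv, ← Real.sqrt_inv,
          ← Real.sqrt_mul (by positivity)]
        congr 2
        field_simp

lemma lintegral_exp_mul_gaussianReal (v : ℝ≥0) (t : ℝ) :
    ∫⁻ x, ENNReal.ofReal (Real.exp (t * x)) ∂(gaussianReal 0 v) =
      ENNReal.ofReal (Real.exp (v * t ^ 2 / 2)) := by
  rw [← ofReal_integral_eq_lintegral_ofReal (integrable_exp_mul_gaussianReal t)
    (Eventually.of_forall fun x => (Real.exp_pos _).le)]
  have := mgf_gaussianReal (p := gaussianReal 0 v) (X := id) (μ := 0) (v := v) Measure.map_id t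
  simp only [mgf, id] at this
  rw [this]
  simp

lemma lintegral_prod_pi_eq_prod_lintegral {ι : Type*} [Fintype ι] (μ : ι → Measure ℝ)
    [∀ i, IsProbabilityMeasure (μ i)] {f : ι → ℝ → ℝ≥0∞} (hf : ∀ i, Measurable (f i)) :
    ∫⁻ x, ∏ i, f i (x i) ∂(Measure.pi μ) = ∏ i, ∫⁻ t, f i t ∂(μ i) := by
  rw [lintegral_prod_eq_prod_lintegral_of_indepFun Finset.univ (fun i (x : ι → ℝ) => f i (x i))
    (iIndepFun_pi fun i => (hf i).aemeasurable) (fun i => (hf i).comp (measurable_pi_apply i))]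
  refine Finset.prod_congr rfl fun i _ => ?_
  exact (measurePreserving_eval μ i).lintegral_comp (hf i)

/-- Both signs of `u` are needed: positive for the lower tail of `|e|²`, negative for the
exponential moment of a projection. -/
lemma lintegral_exp_dotProduct_self {ι : Type*} [Fintype ι] {u : ℝ} (hu : -1 < u) {v : ℝ≥0}
    (hv : v ≠ 0) :
    ∫⁻ x : ι → ℝ, ENNReal.ofReal (Real.exp (-u * (x ⬝ᵥ x) / (2 * v)))
        ∂(Measure.pi fun _ => gaussianReal 0 v) =
      ENNReal.ofReal ((√(1 + u))⁻¹ ^ Fintype.card ι) := by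
  have h : ∀ x : ι → ℝ, ENNReal.ofReal (Real.exp (-u * (x ⬝ᵥ x) / (2 * v))) =
      ∏ i, ENNReal.ofReal (Real.exp (-u * x i ^ 2 / (2 * v))) := fun x => by
    rw [← ENNReal.ofReal_prod_of_nonneg fun i _ => (Real.exp_pos _).le, ← Real.exp_sum,
      dotProduct, Finset.mul_sum, Finset.sum_div]
    simp only [sq]
  simp_rw [h]
  rw [lintegral_prod_pi_eq_prod_lintegral (f := fun _ t =>
    ENNReal.ofReal (Real.exp (-u * t ^ 2 / (2 * v)))) _ fun i => by fun_prop]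
  simp only [lintegral_exp_sq_gaussianReal hu hv]
  rw [Finset.prod_const, ENNReal.ofReal_pow (by positivity), Finset.card_univ]

lemma lintegral_exp_dotProduct {ι : Type*} [Fintype ι] (v : ℝ≥0) (t : ι → ℝ) :
    ∫⁻ x : ι → ℝ, ENNReal.ofReal (Real.exp (t ⬝ᵥ x))
        ∂(Measure.pi fun _ => gaussianReal 0 v) =
      ENNReal.ofReal (Real.exp (v * (t ⬝ᵥ t) / 2)) := by
  have h : ∀ x : ι → ℝ, ENNReal.ofReal (Real.exp (t ⬝ᵥ x)) =
      ∏ i, ENNReal.ofReal (Real.exp (t i * x i)) := fun x => by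
    rw [← ENNReal.ofReal_prod_of_nonneg fun i _ => (Real.exp_pos _).le, ← Real.exp_sum,
      dotProduct]
  simp_rw [h]
  rw [lintegral_prod_pi_eq_prod_lintegral (f := fun i s =>
    ENNReal.ofReal (Real.exp (t i * s))) _ fun i => by fun_prop]
  simp only [lintegral_exp_mul_gaussianReal]
  rw [← ENNReal.ofReal_prod_of_nonneg fun i _ => (Real.exp_pos _).le, ← Real.exp_sum,
      dotProduct, Finset.mul_sum, Finset.sum_div]
  simp only [sq]

end GaussianIntegrals

/-! ### Exponential moments of projected Gaussian vectors. -/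

section QuadraticForms

open Matrix

variable {m ι : Type*} [Fintype m] [Fintype ι] [DecidableEq ι]

/-- The exponential moment of `|Uᵀ e|²` for an isometry `U`, by linearizing the square with an
auxiliary standard Gaussian vector. -/
lemma lintegral_exp_isometry_sq (U : Matrix m ι ℝ) (hU : Uᵀ * U = 1) {v : ℝ≥0} (hv : v ≠ 0)
    {s : ℝ} (hs0 : 0 ≤ s) (hs1 : s < 1) :
    ∫⁻ e : m → ℝ, ENNReal.ofReal (Real.exp (s * ((Uᵀ *ᵥ e) ⬝ᵥ (Uᵀ *ᵥ e)) / (2 * v)))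
        ∂(Measure.pi fun _ => gaussianReal 0 v) =
      ENNReal.ofReal ((√(1 - s))⁻¹ ^ Fintype.card ι) := by
  have hv' : (0 : ℝ) < v := by positivity
  -- Chosen so that, for standard Gaussian `z`, the mean of `exp(θ ⟨Uᵀe, z⟩)` is `exp(s |Uᵀe|² /
  -- (2v))`.
  set θ : ℝ := √s / √v with hθ
  have hθ2 : θ ^ 2 = s / v := by
    rw [hθ, div_pow, Real.sq_sqrt hs0, Real.sq_sqrt hv'.le]
  have h1 : ∀ e : m → ℝ, ENNReal.ofReal (Real.exp (s * ((Uᵀ *ᵥ e) ⬝ᵥ (Uᵀ *ᵥ e)) / (2 * v))) =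
      ∫⁻ z : ι → ℝ, ENNReal.ofReal (Real.exp (θ * ((U *ᵥ z) ⬝ᵥ e)))
        ∂(Measure.pi fun _ => gaussianReal 0 1) := fun e => by
    have h2 : ∀ z : ι → ℝ, θ * ((U *ᵥ z) ⬝ᵥ e) = (θ • (Uᵀ *ᵥ e)) ⬝ᵥ z := fun z => by
      rw [smul_dotProduct, smul_eq_mul, mulVec_transpose, ← dotProduct_mulVec, dotProduct_comm]
    simp_rw [h2]
    rw [lintegral_exp_dotProduct]
    congr 2
    rw [smul_dotProduct, dotProduct_smul, smul_eq_mul, smul_eq_mul, NNReal.coe_one, one_mul,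
      ← mul_assoc, ← sq, hθ2]
    field_simp
  simp_rw [h1]
  -- Integrating over `e` first leaves `exp(s |Uz|² / 2)`, and `|Uz| = |z|`.
  rw [lintegral_lintegral_swap]
  · have h3 : ∀ z : ι → ℝ, ∫⁻ e : m → ℝ, ENNReal.ofReal (Real.exp (θ * ((U *ᵥ z) ⬝ᵥ e)))
        ∂(Measure.pi fun _ => gaussianReal 0 v) =
        ENNReal.ofReal (Real.exp (-(-s) * (z ⬝ᵥ z) / (2 * (1 : ℝ≥0)))) := fun z => by
      have h4 : ∀ e : m → ℝ, θ * ((U *ᵥ z) ⬝ᵥ e) = (θ • (U *ᵥ z)) ⬝ᵥ e := fun e => by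
        rw [smul_dotProduct, smul_eq_mul]
      have h5 : (U *ᵥ z) ⬝ᵥ (U *ᵥ z) = z ⬝ᵥ z := by
        rw [dotProduct_mulVec, ← mulVec_transpose, mulVec_mulVec, hU, one_mulVec]
      simp_rw [h4]
      rw [lintegral_exp_dotProduct]
      congr 2
      rw [smul_dotProduct, dotProduct_smul, smul_eq_mul, smul_eq_mul, h5,
        ← mul_assoc θ, ← sq, hθ2, NNReal.coe_one]
      field_simp
    simp_rw [h3]
    rw [lintegral_exp_dotProduct_self (by linarith) one_ne_zero, ← sub_eq_add_neg]
  · refine Measurable.aemeasurable ?_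
    refine ENNReal.measurable_ofReal.comp (Real.measurable_exp.comp (Measurable.const_mul ?_ _))
    refine Continuous.measurable ?_
    refine Continuous.dotProduct ?_ ?_ <;> fun_prop

lemma lintegral_exp_projection (A : Matrix m ι ℝ) {v : ℝ≥0} (hv : v ≠ 0)
    {s : ℝ} (hs0 : 0 ≤ s) (hs1 : s < 1) :
    ∫⁻ e : m → ℝ,
        ENNReal.ofReal (Real.exp (s * (e ⬝ᵥ ((A * (Aᵀ * A)⁻¹ * Aᵀ) *ᵥ e)) / (2 * v)))
        ∂(Measure.pi fun _ => gaussianReal 0 v) ≤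
      ENNReal.ofReal ((√(1 - s))⁻¹ ^ Fintype.card ι) := by
  by_cases hA : IsUnit (Aᵀ * A).det
  · obtain ⟨U, hU, hP⟩ := exists_isometry_factor A hA
    rw [← lintegral_exp_isometry_sq U hU hv hs0 hs1, hP]
    refine le_of_eq (lintegral_congr fun e => ?_)
    rw [← mulVec_mulVec, dotProduct_mulVec e, ← mulVec_transpose]
  -- For a singular Gram matrix the inverse is `0` by convention and the integral is `1`. Covering
  -- this case makes the bound hold for every realization of the design.
  · rw [nonsing_inv_apply_not_isUnit _ hA]
    have hq : √(1 - s) ≤ 1 := Real.sqrt_le_one.mpr (by linarith)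
    have hq0 : 0 < √(1 - s) := Real.sqrt_pos.mpr (by linarith)
    simp only [Matrix.mul_zero, Matrix.zero_mul, zero_mulVec, dotProduct_zero, mul_zero, zero_div,
      Real.exp_zero, ENNReal.ofReal_one, lintegral_const, measure_univ, mul_one]
    exact ENNReal.one_le_ofReal.mpr (one_le_pow₀ ((one_le_inv₀ hq0).mpr hq))

end QuadraticForms

/-! ### Marginal densities of the models. -/

section Marginal

open Matrix

variable {n p : ℕ}

/-- The marginal density of a response whose residual sum of squares is `R`, up to the volume
factor of the coefficients. -/
noncomputable def precisionIntegral (n : ℕ) (ν R : ℝ) : ℝ≥0∞ :=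
  ∫⁻ τ, ENNReal.ofReal ((√(2 * Real.pi * τ⁻¹))⁻¹ ^ n * Real.exp (-τ * R / 2)) ∂(chiSquare ν)

lemma ae_chiSquare_pos (ν : ℝ) : ∀ᵐ τ ∂(chiSquare ν), 0 < τ := by
  have hac : ∀ᵐ τ ∂(chiSquare ν), τ ≠ 0 :=
    (withDensity_absolutelyContinuous volume _).ae_le (Measure.ae_ne volume 0)
  have hnn : ∀ᵐ τ ∂(chiSquare ν), 0 ≤ τ := by
    have hm : Measurable (gammaPDF (ν / 2) (1 / 2)) :=
      ENNReal.measurable_ofReal.comp (measurable_gammaPDFReal _ _)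
    rw [chiSquare, gammaMeasure, ae_withDensity_iff hm]
    refine Eventually.of_forall fun τ hτ => ?_
    by_contra h
    exact hτ (gammaPDF_of_neg (not_le.mp h))
  filter_upwards [hac, hnn] with τ h1 h2
  exact lt_of_le_of_ne h2 (Ne.symm h1)

/-- Gamma conjugacy: the integrand in `τ` is a multiple of the Gamma density with shape `(n + ν)/2`
and rate `(1 + R)/2`. What matters is that `K` does not depend on `R`. -/
lemma exists_precisionIntegral_eq (n : ℕ) {ν : ℝ} (hν : 0 < ν) :
    ∃ K : ℝ, 0 < K ∧ ∀ R : ℝ, 0 ≤ R →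
      precisionIntegral n ν R = ENNReal.ofReal (K * (1 + R) ^ (-((n + ν) / 2))) := by
  set A : ℝ := (n + ν) / 2 with hA
  have hA0 : 0 < A := by positivity
  have hΓ : 0 < Real.Gamma (ν / 2) := Real.Gamma_pos_of_pos (by positivity)
  have hΓA : 0 < Real.Gamma A := Real.Gamma_pos_of_pos hA0
  refine ⟨(1 / 2) ^ (ν / 2) / Real.Gamma (ν / 2) * (√(2 * Real.pi))⁻¹ ^ n *
    Real.Gamma A * 2 ^ A, by positivity, fun R hR => ?_⟩
  set K : ℝ := (1 / 2) ^ (ν / 2) / Real.Gamma (ν / 2) * (√(2 * Real.pi))⁻¹ ^ n *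
    Real.Gamma A * 2 ^ A with hK
  have hR1 : 0 < 1 + R := by linarith
  have hmeas : Measurable (gammaPDF (ν / 2) (1 / 2)) :=
    ENNReal.measurable_ofReal.comp (measurable_gammaPDFReal _ _)
  have hmeas' : Measurable (gammaPDF A ((1 + R) / 2)) :=
    ENNReal.measurable_ofReal.comp (measurable_gammaPDFReal _ _)
  rw [precisionIntegral, chiSquare, gammaMeasure,
    lintegral_withDensity_eq_lintegral_mul _ hmeas (by fun_prop)]
  calc _ = ∫⁻ τ, ENNReal.ofReal (K * (1 + R) ^ (-A)) * gammaPDF A ((1 + R) / 2) τ := by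
        refine lintegral_congr_ae ?_
        filter_upwards [Measure.ae_ne volume (0 : ℝ)] with τ hτ0
        simp only [Pi.mul_apply]
        rcases lt_or_gt_of_ne hτ0 with hτ | hτ
        · rw [gammaPDF_of_neg hτ, gammaPDF_of_neg hτ, zero_mul, mul_zero]
        · rw [gammaPDF_of_nonneg hτ.le, gammaPDF_of_nonneg hτ.le,
            ← ENNReal.ofReal_mul (by positivity), ← ENNReal.ofReal_mul (by positivity)]
          congr 1
          have e1 : (√(2 * Real.pi * τ⁻¹))⁻¹ ^ n = (√(2 * Real.pi))⁻¹ ^ n * τ ^ ((n : ℝ) / 2) := by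
            rw [Real.sqrt_mul (by positivity), mul_inv, mul_pow, Real.sqrt_inv, inv_inv,
              Real.sqrt_eq_rpow τ, ← Real.rpow_natCast (τ ^ (1 / 2 : ℝ)), ← Real.rpow_mul hτ.le]
            congr 2
            ring
          have e2 : τ ^ (A - 1) = τ ^ (ν / 2 - 1) * τ ^ ((n : ℝ) / 2) := by
            rw [← Real.rpow_add hτ]
            congr 1
            rw [hA]; ring
          have e3 : Real.exp (-((1 + R) / 2 * τ)) =
              Real.exp (-(1 / 2 * τ)) * Real.exp (-τ * R / 2) := by
            rw [← Real.exp_add]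
            congr 1
            ring
          have e4 : (1 + R) ^ (-A) * ((1 + R) / 2) ^ A = (2 ^ A)⁻¹ := by
            rw [Real.div_rpow hR1.le (by norm_num), Real.rpow_neg hR1.le]
            field_simp
          rw [e1, e2, e3]
          calc _ = (1 / 2) ^ (ν / 2) / Real.Gamma (ν / 2) * (√(2 * Real.pi))⁻¹ ^ n *
                (τ ^ (ν / 2 - 1) * τ ^ ((n : ℝ) / 2)) *
                (Real.exp (-(1 / 2 * τ)) * Real.exp (-τ * R / 2)) := by ring
            _ = K * ((2 ^ A)⁻¹ / Real.Gamma A) *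
                (τ ^ (ν / 2 - 1) * τ ^ ((n : ℝ) / 2)) *
                (Real.exp (-(1 / 2 * τ)) * Real.exp (-τ * R / 2)) := by
                congr 2
                rw [hK]
                field_simp
            _ = _ := by rw [← e4]; ring
    _ = ENNReal.ofReal (K * (1 + R) ^ (-A)) := by
        rw [lintegral_const_mul _ hmeas', lintegral_gammaPDF_eq_one hA0 (by positivity), mul_one]

lemma likelihood_eq (X : Matrix (Fin n) (Fin p) ℝ) (β : Fin p → ℝ) {τ : ℝ} (hτ : 0 < τ)
    (y : Fin n → ℝ) :
    likelihood X β τ⁻¹ y = ENNReal.ofReal ((√(2 * Real.pi * τ⁻¹))⁻¹ ^ n *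
      Real.exp (-τ * ((y - X *ᵥ β) ⬝ᵥ (y - X *ᵥ β)) / 2)) := by
  have hc : ((τ⁻¹.toNNReal : ℝ≥0) : ℝ) = τ⁻¹ := Real.coe_toNNReal _ (by positivity)
  simp only [likelihood, gaussianPDF, gaussianPDFReal, hc]
  rw [← ENNReal.ofReal_prod_of_nonneg fun i _ => by positivity, Finset.prod_mul_distrib,
    Finset.prod_const, Finset.card_univ, Fintype.card_fin, ← Real.exp_sum, dotProduct,
    Finset.mul_sum, Finset.sum_div]
  congr 3
  refine Finset.sum_congr rfl fun i _ => ?_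
  simp only [Pi.sub_apply]
  field_simp

instance isProbabilityMeasure_coefPrior_component (c : Fin p → ℝ) (γ : Finset (Fin p)) (v : ℝ)
    (j : Fin p) : IsProbabilityMeasure
      (if j ∈ γ then gaussianReal 0 (c j * v).toNNReal else Measure.dirac (0 : ℝ)) := by
  split_ifs <;> infer_instance

lemma ae_coefPrior_eq_zero (c : Fin p → ℝ) (γ : Finset (Fin p)) (v : ℝ) :
    ∀ᵐ β ∂(coefPrior c γ v), ∀ j ∉ γ, β j = 0 := by
  rw [eventually_countable_forall]
  intro j
  by_cases hj : j ∈ γ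
  · exact Eventually.of_forall fun β h => absurd hj h
  · have h0 : ∀ᵐ t ∂(if j ∈ γ then gaussianReal 0 (c j * v).toNNReal
        else Measure.dirac (0 : ℝ)), t = 0 := by
      rw [if_neg hj, ae_dirac_eq]
      exact rfl
    have := (Measure.tendsto_eval_ae_ae (μ := fun j => if j ∈ γ then
      gaussianReal 0 (c j * v).toNNReal else Measure.dirac (0 : ℝ)) (i := j)).eventually h0
    filter_upwards [this] with β hβ _
    exact hβ

lemma mulVec_eq_cols_mulVec (X : Matrix (Fin n) (Fin p) ℝ) (γ : Finset (Fin p)) {β : Fin p → ℝ}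
    (hβ : ∀ j ∉ γ, β j = 0) : X *ᵥ β = cols X γ *ᵥ fun j => β j := by
  ext i
  simp only [mulVec, dotProduct, cols, submatrix_apply, id]
  rw [Finset.sum_coe_sort γ (fun j => X i j * β j)]
  refine (Finset.sum_subset (Finset.subset_univ γ) fun j _ hj => ?_).symm
  rw [hβ j hj, mul_zero]

instance isProbabilityMeasure_coefPrior (c : Fin p → ℝ) (γ : Finset (Fin p)) (v : ℝ) :
    IsProbabilityMeasure (coefPrior c γ v) := by
  unfold coefPrior; infer_instance

lemma marginal_empty (ν : ℝ) (c : Fin p → ℝ) (X : Matrix (Fin n) (Fin p) ℝ) (y : Fin n → ℝ) :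
    marginal ν c X y ∅ = precisionIntegral n ν (y ⬝ᵥ y) := by
  refine lintegral_congr_ae ?_
  filter_upwards [ae_chiSquare_pos ν] with τ hτ
  calc _ = ∫⁻ β, ENNReal.ofReal ((√(2 * Real.pi * τ⁻¹))⁻¹ ^ n * Real.exp (-τ * (y ⬝ᵥ y) / 2))
        ∂(coefPrior c ∅ τ⁻¹) := by
        refine lintegral_congr_ae ?_
        filter_upwards [ae_coefPrior_eq_zero c ∅ τ⁻¹] with β hβ
        have : β = 0 := funext fun j => hβ j (by simp)
        rw [likelihood_eq X β hτ, this, mulVec_zero, sub_zero]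
    _ = _ := by simp

/-- The residual sum of squares of the model `γ`. -/
noncomputable def residualSS (X : Matrix (Fin n) (Fin p) ℝ) (y : Fin n → ℝ) (γ : Finset (Fin p)) :
    ℝ :=
  y ⬝ᵥ y - y ⬝ᵥ (projMatrix X γ *ᵥ y)

/-- After completing the square, the Gram bound dominates the likelihood by a product of
one-dimensional Gaussian bumps centred at the least squares estimate, which the product prior
integrates coordinate by coordinate. -/
lemma marginal_le (ν : ℝ) {c : Fin p → ℝ} (X : Matrix (Fin n) (Fin p) ℝ) (y : Fin n → ℝ)
    (γ : Finset (Fin p)) {a r : ℝ} (ha : 0 < a) (hc : ∀ j, a ≤ c j) (hr : 0 < r)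
    (h : ∀ v : {j // j ∈ γ} → ℝ, r * (v ⬝ᵥ v) ≤ (cols X γ *ᵥ v) ⬝ᵥ (cols X γ *ᵥ v)) :
    marginal ν c X y γ ≤
      ENNReal.ofReal ((√(r * a))⁻¹ ^ γ.card) * precisionIntegral n ν (residualSS X y γ) := by
  obtain ⟨b, hb⟩ := exists_leastSquares_decomposition (cols X γ) (isUnit_det_gram hr h) y
  set b' : Fin p → ℝ := fun j => if hj : j ∈ γ then b ⟨j, hj⟩ else 0 with hb'
  rw [precisionIntegral, ← lintegral_const_mul _ (by fun_prop)]
  refine lintegral_mono_ae ?_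
  filter_upwards [ae_chiSquare_pos ν] with τ hτ
  set f : Fin p → ℝ → ℝ≥0∞ := fun j t =>
    if j ∈ γ then ENNReal.ofReal (Real.exp (-(τ * r) * (t - b' j) ^ 2 / 2)) else 1 with hf
  have hfm : ∀ j, Measurable (f j) := fun j => by
    simp only [hf]; split_ifs <;> fun_prop
  set M : ℝ≥0∞ := ENNReal.ofReal ((√(2 * Real.pi * τ⁻¹))⁻¹ ^ n *
    Real.exp (-τ * residualSS X y γ / 2)) with hM
  have hpt : ∀ β : Fin p → ℝ, (∀ j ∉ γ, β j = 0) → likelihood X β τ⁻¹ y ≤ M * ∏ j, f j (β j) := by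
    intro β hβ
    have hprod : ∏ j, f j (β j) =
        ENNReal.ofReal (Real.exp (∑ j ∈ γ, -(τ * r) * (β j - b' j) ^ 2 / 2)) := by
      rw [Real.exp_sum, ENNReal.ofReal_prod_of_nonneg fun i _ => (Real.exp_pos _).le]
      simp only [hf]
      rw [Finset.prod_ite_mem, Finset.univ_inter]
    rw [likelihood_eq X β hτ, hprod, hM, ← ENNReal.ofReal_mul (by positivity),
      mul_assoc (_ ^ n), ← Real.exp_add]
    refine ENNReal.ofReal_le_ofReal ?_
    gcongr
    rw [mulVec_eq_cols_mulVec X γ hβ, hb]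
    have hsum : ((fun j : {j // j ∈ γ} => β j) - b) ⬝ᵥ ((fun j : {j // j ∈ γ} => β j) - b) =
        ∑ j ∈ γ, (β j - b' j) ^ 2 := by
      rw [← Finset.sum_coe_sort γ fun j => (β j - b' j) ^ 2, dotProduct]
      refine Finset.sum_congr rfl fun j _ => ?_
      simp [hb', sq]
    have h1 := h ((fun j : {j // j ∈ γ} => β j) - b)
    rw [hsum] at h1
    rw [← Finset.sum_div, ← Finset.mul_sum]
    have h2 : y ⬝ᵥ y - y ⬝ᵥ ((cols X γ * ((cols X γ)ᵀ * cols X γ)⁻¹ * (cols X γ)ᵀ) *ᵥ y) =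
        residualSS X y γ := rfl
    rw [h2]
    have h3 := mul_le_mul_of_nonneg_left h1 hτ.le
    linarith
  calc ∫⁻ β, likelihood X β τ⁻¹ y ∂(coefPrior c γ τ⁻¹)
      ≤ ∫⁻ β, M * ∏ j, f j (β j) ∂(coefPrior c γ τ⁻¹) := by
        refine lintegral_mono_ae ?_
        filter_upwards [ae_coefPrior_eq_zero c γ τ⁻¹] with β hβ using hpt β hβ
    _ = M * ∏ j, ∫⁻ t, f j t ∂(if j ∈ γ then gaussianReal 0 (c j * τ⁻¹).toNNReal
          else Measure.dirac (0 : ℝ)) := by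
        have hfm' : Measurable fun β : Fin p → ℝ => ∏ j, f j (β j) :=
          Finset.measurable_fun_prod _ fun j _ => (hfm j).comp (measurable_pi_apply j)
        rw [lintegral_const_mul _ hfm', coefPrior, lintegral_prod_pi_eq_prod_lintegral _ hfm]
    _ ≤ M * ∏ j, (if j ∈ γ then ENNReal.ofReal (√(r * a))⁻¹ else 1) := by
        gcongr with j _
        simp only [hf]
        split_ifs with hj
        · have hcj : 0 < c j := ha.trans_le (hc j)
          have hcτ : 0 < c j * τ⁻¹ := by positivity
          refine (lintegral_exp_sq_sub_gaussianReal_le (by positivity)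
            (Real.toNNReal_pos.mpr hcτ).ne' _).trans (ENNReal.ofReal_le_ofReal ?_)
          rw [Real.coe_toNNReal _ hcτ.le]
          -- The prior variance scales with `σ²`, so `τ` cancels and the factor leaves the precision
          -- integral.
          have : τ * r * (c j * τ⁻¹) = r * c j := by field_simp
          rw [this]
          have := hc j
          gcongr
        · simp
    _ = ENNReal.ofReal ((√(r * a))⁻¹ ^ γ.card) * M := by
        rw [Finset.prod_ite_mem, Finset.univ_inter, Finset.prod_const,
          ENNReal.ofReal_pow (by positivity), mul_comm]

lemma residualSS_nonneg (X : Matrix (Fin n) (Fin p) ℝ) (y : Fin n → ℝ)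
    (γ : Finset (Fin p)) (h : IsUnit ((cols X γ)ᵀ * cols X γ).det) : 0 ≤ residualSS X y γ := by
  obtain ⟨b, hb⟩ := exists_leastSquares_decomposition (cols X γ) h y
  have h1 := hb b
  rw [sub_self, mulVec_zero, zero_dotProduct, add_zero] at h1
  rw [residualSS, projMatrix, ← h1]
  exact Finset.sum_nonneg fun i _ => mul_self_nonneg _

end Marginal

/-! ### Posterior odds against the null model. -/

section Posterior

open Matrix

variable {n p : ℕ}

lemma posterior_div_posterior {π : PMF (Finset (Fin p))} {ν : ℝ} {c : Fin p → ℝ}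
    {X : Matrix (Fin n) (Fin p) ℝ} {y : Fin n → ℝ} {γ₀ : Finset (Fin p)}
    (hfin : ∀ γ, marginal ν c X y γ ≠ ⊤) (h0 : π γ₀ * marginal ν c X y γ₀ ≠ 0)
    (γ : Finset (Fin p)) :
    posterior π ν c X y γ / posterior π ν c X y γ₀ =
      π γ / π γ₀ * (marginal ν c X y γ / marginal ν c X y γ₀) := by
  have hT : ∀ γ, π γ * marginal ν c X y γ ≠ ⊤ := fun γ =>
    ENNReal.mul_ne_top (π.apply_ne_top γ) (hfin γ)
  have hD : ∑ γ, π γ * marginal ν c X y γ ≠ ⊤ := ENNReal.sum_ne_top.mpr fun γ _ => hT γ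
  have hD0 : ∑ γ, π γ * marginal ν c X y γ ≠ 0 := fun h =>
    h0 (Finset.sum_eq_zero_iff.mp h γ₀ (Finset.mem_univ _))
  rw [posterior, posterior, ENNReal.div_eq_inv_mul (a := π γ * marginal ν c X y γ),
    ENNReal.div_eq_inv_mul (a := π γ₀ * marginal ν c X y γ₀),
    ENNReal.mul_div_mul_left _ _ (ENNReal.inv_ne_zero.mpr hD) (ENNReal.inv_ne_top.mpr hD0)]
  rw [ENNReal.div_eq_inv_mul, ENNReal.mul_inv (Or.inr (hfin γ₀)) (Or.inl (π.apply_ne_top γ₀))]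
  simp only [ENNReal.div_eq_inv_mul]
  ring

lemma sum_posterior {π : PMF (Finset (Fin p))} {ν : ℝ} {c : Fin p → ℝ}
    {X : Matrix (Fin n) (Fin p) ℝ} {y : Fin n → ℝ} {γ₀ : Finset (Fin p)}
    (hfin : ∀ γ, marginal ν c X y γ ≠ ⊤) (h0 : π γ₀ * marginal ν c X y γ₀ ≠ 0) :
    ∑ γ, posterior π ν c X y γ = 1 := by
  have hD : ∑ γ, π γ * marginal ν c X y γ ≠ ⊤ := ENNReal.sum_ne_top.mpr fun γ _ =>
    ENNReal.mul_ne_top (π.apply_ne_top γ) (hfin γ)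
  have hD0 : ∑ γ, π γ * marginal ν c X y γ ≠ 0 := fun h =>
    h0 (Finset.sum_eq_zero_iff.mp h γ₀ (Finset.mem_univ _))
  simp only [posterior, div_eq_mul_inv]
  rw [← Finset.sum_mul, ENNReal.mul_inv_cancel hD0 hD]

/-- If `π a₀` vanished, the ratio at any support point would be `⊤`. -/
lemma pmf_apply_ne_zero_of_div_le {α : Type*} (π : PMF α) {a₀ : α} {C : ℝ}
    (h : ∀ a, π a / π a₀ ≤ ENNReal.ofReal C) : π a₀ ≠ 0 := by
  intro h0
  obtain ⟨a, ha⟩ := π.support_nonempty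
  have := h a
  rw [h0, ENNReal.div_zero ((π.mem_support_iff a).mp ha)] at this
  exact ENNReal.ofReal_ne_top (top_le_iff.mp this)

/-- For a well-conditioned design the posterior is a probability vector, and its odds against the
null model are bounded through the residual sum of squares. -/
lemma posterior_odds_le {π : PMF (Finset (Fin p))} {ν C₀ : ℝ} (hν : 0 < ν) (hC₀ : 0 < C₀)
    (hπ : ∀ γ, π γ / π ∅ ≤ ENNReal.ofReal C₀) {c : Fin p → ℝ} {X : Matrix (Fin n) (Fin p) ℝ}
    (y : Fin n → ℝ) {a r : ℝ} (ha : 0 < a) (hc : ∀ j, a ≤ c j) (hr : 0 < r)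
    (h : ∀ (γ : Finset (Fin p)) (v : {j // j ∈ γ} → ℝ),
      r * (v ⬝ᵥ v) ≤ (cols X γ *ᵥ v) ⬝ᵥ (cols X γ *ᵥ v)) :
    ∑ γ, posterior π ν c X y γ = 1 ∧ ∀ γ,
      posterior π ν c X y γ / posterior π ν c X y ∅ ≤
        ENNReal.ofReal (C₀ * ((√(r * a))⁻¹ ^ γ.card *
          ((1 + y ⬝ᵥ y) / (1 + residualSS X y γ)) ^ (((n : ℝ) + ν) / 2))) := by
  obtain ⟨K, hK, hJ⟩ := exists_precisionIntegral_eq n hν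
  have hR : ∀ γ, 0 ≤ residualSS X y γ := fun γ =>
    residualSS_nonneg X y γ (isUnit_det_gram hr (h γ))
  have hy : 0 ≤ y ⬝ᵥ y := Finset.sum_nonneg fun i _ => mul_self_nonneg _
  have hm : ∀ γ, marginal ν c X y γ ≤ ENNReal.ofReal ((√(r * a))⁻¹ ^ γ.card *
      (K * (1 + residualSS X y γ) ^ (-(((n : ℝ) + ν) / 2)))) := fun γ => by
    rw [ENNReal.ofReal_mul (by positivity), ← hJ _ (hR γ)]
    exact marginal_le ν X y γ ha hc hr (h γ)
  have hfin : ∀ γ, marginal ν c X y γ ≠ ⊤ := fun γ => ne_top_of_le_ne_top ENNReal.ofReal_ne_top (hm γ)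
  have hm0 : marginal ν c X y ∅ =
      ENNReal.ofReal (K * (1 + y ⬝ᵥ y) ^ (-(((n : ℝ) + ν) / 2))) := by
    rw [marginal_empty, hJ _ hy]
  have hpos : 0 < K * (1 + y ⬝ᵥ y) ^ (-(((n : ℝ) + ν) / 2)) := by positivity
  have h0 : π ∅ * marginal ν c X y ∅ ≠ 0 := by
    refine mul_ne_zero (pmf_apply_ne_zero_of_div_le π hπ) ?_
    rw [hm0]
    exact (ENNReal.ofReal_pos.mpr hpos).ne'
  refine ⟨sum_posterior hfin h0, fun γ => ?_⟩
  rw [posterior_div_posterior hfin h0, ENNReal.ofReal_mul hC₀.le]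
  refine mul_le_mul' (hπ γ) ?_
  rw [hm0]
  refine (ENNReal.div_le_div_right (hm γ) _).trans ?_
  rw [← ENNReal.ofReal_div_of_pos hpos]
  refine ENNReal.ofReal_le_ofReal (le_of_eq ?_)
  have hRγ : 0 < 1 + residualSS X y γ := by linarith [hR γ]
  rw [Real.div_rpow (by positivity) hRγ.le, Real.rpow_neg (by positivity : 0 ≤ 1 + y ⬝ᵥ y),
    Real.rpow_neg hRγ.le]
  field_simp

lemma div_rpow_le_exp {s t A : ℝ} (ht : 0 < t) (hs : 0 ≤ s) (hA : 0 ≤ A) :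
    (s / t) ^ A ≤ Real.exp (A * ((s - t) / t)) := by
  have h1 : s / t ≤ Real.exp ((s - t) / t) := by
    have := Real.add_one_le_exp ((s - t) / t)
    have h2 : (s - t) / t + 1 = s / t := by field_simp; ring
    linarith
  calc (s / t) ^ A ≤ Real.exp ((s - t) / t) ^ A := by gcongr
    _ = _ := by rw [← Real.exp_mul, mul_comm]

lemma sum_erase_empty_pow_card (x : ℝ) :
    ∑ γ ∈ (Finset.univ : Finset (Finset (Fin p))).erase ∅, x ^ γ.card = (1 + x) ^ p - 1 := by
  have h1 : ∑ γ : Finset (Fin p), x ^ γ.card = (1 + x) ^ p := by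
    have := Fintype.sum_pow_mul_eq_add_pow (Fin p) x 1
    simpa [add_comm] using this
  rw [← h1, ← Finset.add_sum_erase _ _ (Finset.mem_univ (∅ : Finset (Fin p)))]
  simp

/-- Binomial theorem and `1 + x ≤ exp x`. It serves both the union bound over models and the sum of
the odds. -/
lemma sum_erase_empty_pow_card_le {x : ℝ} (hx : 0 ≤ x) :
    ∑ γ ∈ (Finset.univ : Finset (Finset (Fin p))).erase ∅, x ^ γ.card ≤ Real.exp (p * x) - 1 := by
  rw [sum_erase_empty_pow_card, Real.exp_nat_mul]
  have := Real.add_one_le_exp x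
  have h2 : (1 + x) ^ p ≤ Real.exp x ^ p := by
    gcongr
    linarith
  linarith

/-- On the event that the squared norm of the response is close to its mean and that the fitted
sums of squares are small, the odds decay geometrically in the size of the model. -/
lemma posterior_odds_le_of_event {π : PMF (Finset (Fin p))} {ν C₀ : ℝ} (hν : 0 < ν) (hC₀ : 0 < C₀)
    (hπ : ∀ γ, π γ / π ∅ ≤ ENNReal.ofReal C₀) {c : Fin p → ℝ} {X : Matrix (Fin n) (Fin p) ℝ}
    (y : Fin n → ℝ) {a r : ℝ} (ha : 0 < a) (hc : ∀ j, a ≤ c j) (hr : 0 < r)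
    (h : ∀ (γ : Finset (Fin p)) (v : {j // j ∈ γ} → ℝ),
      r * (v ⬝ᵥ v) ≤ (cols X γ *ᵥ v) ⬝ᵥ (cols X γ *ᵥ v))
    (hn : 0 < n) (hp : 0 < p) {s η q : ℝ} (hs : 0 < s) (hη : 0 < η) (hη2 : 2 * η < 1)
    (hplog : 2 * (1 + η) * (p * Real.log p) ≤ η * n)
    (hq : (1 + ν / n) * (1 + η) ≤ q * (1 - 2 * η))
    (hy : (1 - η) * (n * s) ≤ y ⬝ᵥ y) {γ : Finset (Fin p)}
    (hγ : y ⬝ᵥ (projMatrix X γ *ᵥ y) ≤ 2 * (1 + η) * s * γ.card * Real.log p) :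
    posterior π ν c X y γ / posterior π ν c X y ∅ ≤
        ENNReal.ofReal (C₀ * (((p : ℝ) ^ q * (√(r * a))⁻¹) ^ γ.card)) := by
  refine ((posterior_odds_le hν hC₀ hπ y ha hc hr h).2 γ).trans (ENNReal.ofReal_le_ofReal ?_)
  have hn' : (0 : ℝ) < n := by exact_mod_cast hn
  have hp' : (1 : ℝ) ≤ p := by exact_mod_cast hp
  have hlog : 0 ≤ Real.log p := Real.log_nonneg hp'
  have hcard : (γ.card : ℝ) ≤ p := by
    exact_mod_cast (Finset.card_le_univ γ).trans (by simp)
  have hyy : 0 ≤ y ⬝ᵥ y := Finset.sum_nonneg fun i _ => mul_self_nonneg _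
  -- As `|γ| ≤ p`, `hplog` bounds the fitted sum of squares by `η n s`; this takes a second `η` off
  -- the lower bound for `|y|²`.
  have hR : (1 - 2 * η) * (n * s) ≤ residualSS X y γ := by
    have h1 : 2 * (1 + η) * s * γ.card * Real.log p ≤ 2 * (1 + η) * s * p * Real.log p := by
      gcongr
    have h2 : s * (2 * (1 + η) * (p * Real.log p)) ≤ s * (η * n) := by gcongr
    rw [residualSS]
    nlinarith
  have hns : 0 < (1 - 2 * η) * (n * s) := mul_pos (by linarith) (by positivity)
  have hexp : ((1 + y ⬝ᵥ y) / (1 + residualSS X y γ)) ^ (((n : ℝ) + ν) / 2) ≤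
      ((p : ℝ) ^ q) ^ γ.card := by
    refine (div_rpow_le_exp (by linarith) (by positivity) (by positivity)).trans ?_
    rw [Real.rpow_def_of_pos (by linarith), ← Real.exp_nat_mul]
    refine Real.exp_le_exp.mpr ?_
    have h3 : 1 + y ⬝ᵥ y - (1 + residualSS X y γ) = y ⬝ᵥ (projMatrix X γ *ᵥ y) := by
      rw [residualSS]; ring
    rw [h3]
    have hB : 0 ≤ 2 * (1 + η) * s * γ.card * Real.log p := by positivity
    calc ((n : ℝ) + ν) / 2 * (y ⬝ᵥ (projMatrix X γ *ᵥ y) / (1 + residualSS X y γ))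
        ≤ ((n : ℝ) + ν) / 2 * ((2 * (1 + η) * s * γ.card * Real.log p) /
            ((1 - 2 * η) * (n * s))) := by
          gcongr ?_ * ?_
          refine (div_le_div_of_nonneg_right hγ (by linarith)).trans ?_
          exact div_le_div_of_nonneg_left hB hns (by linarith)
      _ = ((1 + ν / n) * (1 + η)) / (1 - 2 * η) * (γ.card * Real.log p) := by
          have : 1 - 2 * η ≠ 0 := by linarith
          field_simp
      _ ≤ q * (γ.card * Real.log p) := by
          gcongr
          rw [div_le_iff₀ (by linarith)]
          exact hq
      _ = γ.card * (Real.log p * q) := by ring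
  rw [mul_pow, mul_comm (((p : ℝ) ^ q) ^ γ.card)]
  gcongr

end Posterior

/-! ### Large deviations of the noise and of its projections. -/

section Deviations

open Matrix

variable {n p : ℕ}

/-- The inverse is the inverted determinant times the adjugate: measurable everywhere, singular
matrices included. -/
lemma measurable_projMatrix_apply (γ : Finset (Fin p)) (i j : Fin n) :
    Measurable fun x : Fin n → Fin p → ℝ => projMatrix (Matrix.of x) γ i j := by
  have hcols : Continuous fun x : Fin n → Fin p → ℝ => cols (Matrix.of x) γ :=
    Continuous.matrix_submatrix continuous_id _ _
  have hgram : Continuous fun x : Fin n → Fin p → ℝ =>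
      (cols (Matrix.of x) γ)ᵀ * cols (Matrix.of x) γ := hcols.matrix_transpose.matrix_mul hcols
  have hinv : ∀ k l, Measurable fun x : Fin n → Fin p → ℝ =>
      ((cols (Matrix.of x) γ)ᵀ * cols (Matrix.of x) γ)⁻¹ k l := fun k l => by
    simp only [Matrix.inv_def, Ring.inverse_eq_inv', Matrix.smul_apply, smul_eq_mul]
    exact hgram.matrix_det.measurable.inv.mul
      (hgram.matrix_adjugate.matrix_elem k l).measurable
  have hc : ∀ k l, Measurable fun x : Fin n → Fin p → ℝ => cols (Matrix.of x) γ k l :=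
    fun k l => (hcols.matrix_elem k l).measurable
  unfold projMatrix
  generalize hI : (fun x : Fin n → Fin p → ℝ =>
    ((cols (Matrix.of x) γ)ᵀ * cols (Matrix.of x) γ)⁻¹) = I at hinv
  simp only [funext_iff] at hI
  simp only [hI, Matrix.mul_apply, transpose_apply]
  have hinv' : ∀ k l, Measurable fun x => I x k l := fun k l => by
    simpa only [hI] using hinv k l
  exact Finset.measurable_fun_sum _ fun k _ => (Finset.measurable_fun_sum _ fun l _ =>
    (hc i l).mul (hinv' l k)).mul (hc j k)

lemma measurable_fittedSS (γ : Finset (Fin p)) :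
    Measurable fun z : (Fin n → Fin p → ℝ) × (Fin n → ℝ) =>
      z.2 ⬝ᵥ (projMatrix (Matrix.of z.1) γ *ᵥ z.2) := by
  simp only [dotProduct, mulVec]
  have h : ∀ i j, Measurable fun z : (Fin n → Fin p → ℝ) × (Fin n → ℝ) =>
      projMatrix (Matrix.of z.1) γ i j := fun i j =>
    (measurable_projMatrix_apply γ i j).comp measurable_fst
  exact Finset.measurable_fun_sum _ fun i _ => ((measurable_pi_apply i).comp measurable_snd).mul
    (Finset.measurable_fun_sum _ fun j _ => (h i j).mul
      ((measurable_pi_apply j).comp measurable_snd))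

variable {Ω : Type*} [MeasurableSpace Ω] {P : Measure Ω}

lemma measure_le_of_lintegral_exp_le {f : Ω → ℝ} (hf : AEMeasurable f P) {t M : ℝ}
    (hM : ∫⁻ ω, ENNReal.ofReal (Real.exp (f ω)) ∂P ≤ ENNReal.ofReal M) :
    P {ω | t ≤ f ω} ≤ ENNReal.ofReal (M * Real.exp (-t)) := by
  have hpos : 0 < Real.exp t := Real.exp_pos t
  calc P {ω | t ≤ f ω}
      ≤ P {ω | ENNReal.ofReal (Real.exp t) ≤ ENNReal.ofReal (Real.exp (f ω))} := by
        refine measure_mono fun ω hω => ENNReal.ofReal_le_ofReal (Real.exp_le_exp.mpr hω)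
    _ ≤ (∫⁻ ω, ENNReal.ofReal (Real.exp (f ω)) ∂P) / ENNReal.ofReal (Real.exp t) :=
        meas_ge_le_lintegral_div (by fun_prop) (ENNReal.ofReal_pos.mpr hpos).ne'
          ENNReal.ofReal_ne_top
    _ ≤ ENNReal.ofReal M / ENNReal.ofReal (Real.exp t) := ENNReal.div_le_div_right hM _
    _ = _ := by rw [← ENNReal.ofReal_div_of_pos hpos, Real.exp_neg, div_eq_mul_inv]

/-- Chernoff bound for `-|e|²`, with the tilt taken equal to the relative deviation `η`. -/
lemma measure_normSq_lt_le {e : Ω → Fin n → ℝ} {v : ℝ≥0} (hv : v ≠ 0)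
    (he : HasLaw e (Measure.pi fun _ => gaussianReal 0 v) P) {η : ℝ} (hη : 0 < η) :
    P {ω | e ω ⬝ᵥ e ω < (1 - η) * (n * v)} ≤
      ENNReal.ofReal (((√(1 + η))⁻¹ * Real.exp (η * (1 - η) / 2)) ^ n) := by
  have hv' : (0 : ℝ) < v := by positivity
  have hm : Measurable fun x : Fin n → ℝ => x ⬝ᵥ x :=
    (Continuous.dotProduct continuous_id continuous_id).measurable
  have hM : ∫⁻ ω, ENNReal.ofReal (Real.exp (-η * (e ω ⬝ᵥ e ω) / (2 * v))) ∂P ≤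
      ENNReal.ofReal ((√(1 + η))⁻¹ ^ n) := by
    have h1 := lintegral_exp_dotProduct_self (ι := Fin n) (by linarith : -1 < η) hv
    rw [Fintype.card_fin, ← he.map_eq, lintegral_map' (by fun_prop) he.aemeasurable] at h1
    exact h1.le
  have h2 := measure_le_of_lintegral_exp_le (t := -(n * (η * (1 - η) / 2)))
    (((hm.comp_aemeasurable he.aemeasurable).const_mul (-η)).div_const (2 * (v : ℝ))) hM
  rw [neg_neg, Real.exp_nat_mul, ← mul_pow] at h2
  refine (measure_mono fun ω hω => ?_).trans h2
  simp only [Set.mem_ofPred_eq, Function.comp] at hω ⊢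
  rw [le_div_iff₀ (by positivity)]
  nlinarith

variable [IsProbabilityMeasure P]

/-- By independence the design can be frozen, and the exponential moment bound is uniform in the
frozen value. -/
lemma measure_fittedSS_ge_le {X : Ω → Fin n → Fin p → ℝ} {e : Ω → Fin n → ℝ} {v : ℝ≥0}
    (hv : v ≠ 0) (hX : AEMeasurable X P)
    (he : HasLaw e (Measure.pi fun _ => gaussianReal 0 v) P) (hXe : IndepFun X e P)
    (γ : Finset (Fin p)) {s : ℝ} (hs0 : 0 ≤ s) (hs1 : s < 1) (t : ℝ) :
    P {ω | t ≤ s * (e ω ⬝ᵥ (projMatrix (Matrix.of (X ω)) γ *ᵥ e ω)) / (2 * v)} ≤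
      ENNReal.ofReal ((√(1 - s))⁻¹ ^ γ.card * Real.exp (-t)) := by
  have hXe' : AEMeasurable (fun ω => (X ω, e ω)) P := hX.prodMk he.aemeasurable
  have hm := measurable_fittedSS (n := n) γ
  refine measure_le_of_lintegral_exp_le (((hm.comp_aemeasurable hXe').const_mul s).div_const _) ?_
  have hF : Measurable fun z : (Fin n → Fin p → ℝ) × (Fin n → ℝ) => ENNReal.ofReal
      (Real.exp (s * (z.2 ⬝ᵥ (projMatrix (Matrix.of z.1) γ *ᵥ z.2)) / (2 * v))) :=
    ENNReal.measurable_ofReal.comp (Real.measurable_exp.comp ((hm.const_mul s).div_const _))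
  calc _ = ∫⁻ z, ENNReal.ofReal (Real.exp
          (s * (z.2 ⬝ᵥ (projMatrix (Matrix.of z.1) γ *ᵥ z.2)) / (2 * v)))
          ∂(P.map fun ω => (X ω, e ω)) := (lintegral_map' hF.aemeasurable hXe').symm
    _ ≤ ∫⁻ _, ENNReal.ofReal ((√(1 - s))⁻¹ ^ γ.card) ∂(P.map X) := by
        rw [(indepFun_iff_map_prod_eq_prod_map_map hX he.aemeasurable).mp hXe, he.map_eq,
          lintegral_prod _ hF.aemeasurable]
        refine lintegral_mono fun x => ?_
        have := lintegral_exp_projection (cols (Matrix.of x) γ) hv hs0 hs1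
        rwa [Fintype.card_coe] at this
    _ = _ := by
        have := Measure.isProbabilityMeasure_map (μ := P) hX
        rw [lintegral_const, measure_univ, mul_one]

lemma measure_exists_fittedSS_gt_le {X : Ω → Fin n → Fin p → ℝ} {e : Ω → Fin n → ℝ} {v : ℝ≥0}
    (hv : v ≠ 0) (hX : AEMeasurable X P)
    (he : HasLaw e (Measure.pi fun _ => gaussianReal 0 v) P) (hXe : IndepFun X e P)
    (hp : 0 < p) {s : ℝ} (hs0 : 0 < s) (hs1 : s < 1) (η : ℝ) :
    P {ω | ∃ γ : Finset (Fin p), γ ≠ ∅ ∧ 2 * (1 + η) * v * γ.card * Real.log p <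
        e ω ⬝ᵥ (projMatrix (Matrix.of (X ω)) γ *ᵥ e ω)} ≤
      ENNReal.ofReal (Real.exp ((√(1 - s))⁻¹ * (p : ℝ) ^ (1 - s * (1 + η))) - 1) := by
  have hv' : (0 : ℝ) < v := by positivity
  have hp' : (0 : ℝ) < p := by exact_mod_cast hp
  -- The model `γ` contributes at most `x ^ |γ|` to the union bound.
  set x : ℝ := (√(1 - s))⁻¹ * (p : ℝ) ^ (-(s * (1 + η))) with hx
  have hx0 : 0 ≤ x := by positivity
  have hpx : (p : ℝ) * x = (√(1 - s))⁻¹ * (p : ℝ) ^ (1 - s * (1 + η)) := by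
    rw [hx, sub_eq_add_neg 1 (s * (1 + η)), Real.rpow_add hp', Real.rpow_one]
    ring
  calc _ ≤ P (⋃ γ ∈ (Finset.univ : Finset (Finset (Fin p))).erase ∅,
          {ω | s * (1 + η) * γ.card * Real.log p ≤
            s * (e ω ⬝ᵥ (projMatrix (Matrix.of (X ω)) γ *ᵥ e ω)) / (2 * v)}) := by
        refine measure_mono fun ω ⟨γ, hγ, h⟩ => ?_
        simp only [Set.mem_iUnion, Set.mem_ofPred_eq]
        refine ⟨γ, by simp [hγ], ?_⟩
        rw [le_div_iff₀ (by positivity)]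
        have := mul_le_mul_of_nonneg_left h.le hs0.le
        linarith
    _ ≤ ∑ γ ∈ (Finset.univ : Finset (Finset (Fin p))).erase ∅,
          P {ω | s * (1 + η) * γ.card * Real.log p ≤
            s * (e ω ⬝ᵥ (projMatrix (Matrix.of (X ω)) γ *ᵥ e ω)) / (2 * v)} :=
        measure_biUnion_finset_le _ _
    _ ≤ ∑ γ ∈ (Finset.univ : Finset (Finset (Fin p))).erase ∅, ENNReal.ofReal (x ^ γ.card) := by
        refine Finset.sum_le_sum fun γ _ => ?_
        refine (measure_fittedSS_ge_le hv hX he hXe γ hs0.le hs1 _).trans (le_of_eq ?_)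
        rw [hx, mul_pow, Real.rpow_def_of_pos hp', ← Real.exp_nat_mul]
        congr 3
        ring
    _ ≤ _ := by
        rw [← ENNReal.ofReal_sum_of_nonneg fun γ _ => by positivity, ← hpx]
        exact ENNReal.ofReal_le_ofReal (sum_erase_empty_pow_card_le hx0)

end Deviations

/-! ### Exceptional events and limits in probability. -/

section Limits

open Matrix

lemma edist_le_of_le_add {x y t : ℝ≥0∞} (hx : x ≠ ⊤) (hy : y ≠ ⊤) (h1 : x ≤ y + t)
    (h2 : y ≤ x + t) : edist x y ≤ t := by
  lift x to ℝ≥0 using hx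
  lift y to ℝ≥0 using hy
  have h : edist (x : ℝ≥0∞) (y : ℝ≥0∞) = ((max (x - y) (y - x) : ℝ≥0) : ℝ≥0∞) := by
    rw [← NNReal.nndist_eq, ← edist_nndist]
    rfl
  rw [h, ENNReal.coe_max, ENNReal.coe_sub, ENNReal.coe_sub]
  exact max_le (tsub_le_iff_left.mpr h1) (tsub_le_iff_left.mpr h2)

variable {Ω : Type*} [MeasurableSpace Ω] {P : Measure Ω}

/-- Only monotonicity of `P` is used, so suprema over uncountably many `c` need no measurability. -/
lemma tendstoInMeasure_of_exceptional {f : ℕ → Ω → ℝ≥0∞} {g : Ω → ℝ≥0∞} {B : ℕ → Set Ω}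
    (hB : Tendsto (fun n => P (B n)) atTop (𝓝 0)) {u : ℕ → ℝ≥0∞} (hu : Tendsto u atTop (𝓝 0))
    (h : ∀ᶠ n in atTop, ∀ ω ∉ B n, edist (f n ω) (g ω) ≤ u n) :
    TendstoInMeasure P f atTop g := by
  intro ε hε
  refine tendsto_of_tendsto_of_tendsto_of_le_of_le' tendsto_const_nhds hB
    (Eventually.of_forall fun _ => zero_le) ?_
  filter_upwards [h, hu.eventually_lt_const hε] with n hn hun
  refine measure_mono fun ω hω => ?_
  by_contra hωB
  exact absurd ((hn ω hωB).trans_lt hun) (not_lt.mpr hω)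

lemma tendsto_measure_normSq_lt {e : ∀ n : ℕ, Ω → Fin n → ℝ} {v : ℝ≥0}
    (hv : v ≠ 0) (he : ∀ n, 1 ≤ n → HasLaw (e n) (Measure.pi fun _ => gaussianReal 0 v) P)
    {η : ℝ} (hη : 0 < η) (hη1 : η < 1) :
    Tendsto (fun n => P {ω | e n ω ⬝ᵥ e n ω < (1 - η) * (n * v)}) atTop (𝓝 0) := by
  set ρ : ℝ := (√(1 + η))⁻¹ * Real.exp (η * (1 - η) / 2) with hρ
  have hρ0 : 0 ≤ ρ := by positivity
  have hρ1 : ρ < 1 := by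
    have hsq : ρ ^ 2 = Real.exp (η * (1 - η)) / (1 + η) := by
      rw [hρ, mul_pow, inv_pow, Real.sq_sqrt (by linarith), ← Real.exp_nat_mul]
      rw [show ((2 : ℕ) : ℝ) * (η * (1 - η) / 2) = η * (1 - η) by push_cast; ring]
      field_simp
    -- `ρ < 1` follows from this and `(1 + η)(1 - η + η²) = 1 + η³ > 1`.
    have hexp : Real.exp (η * (1 - η)) * (1 - η * (1 - η)) ≤ 1 := by
      have h1 := Real.add_one_le_exp (-(η * (1 - η)))
      calc Real.exp (η * (1 - η)) * (1 - η * (1 - η))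
          ≤ Real.exp (η * (1 - η)) * Real.exp (-(η * (1 - η))) := by
            gcongr; linarith
        _ = 1 := by rw [← Real.exp_add, add_neg_cancel, Real.exp_zero]
    have hlt : Real.exp (η * (1 - η)) < 1 + η := by
      by_contra hcon
      have hpos : 0 < 1 - η * (1 - η) := by nlinarith
      have h3 : (1 + η) * (1 - η * (1 - η)) ≤ 1 :=
        (mul_le_mul_of_nonneg_right (not_lt.mp hcon) hpos.le).trans hexp
      have : 0 < η ^ 3 := by positivity
      nlinarith
    have : ρ ^ 2 < 1 := by rw [hsq, div_lt_one (by linarith)]; exact hlt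
    nlinarith
  have hlim : Tendsto (fun n : ℕ => ENNReal.ofReal (ρ ^ n)) atTop (𝓝 0) := by
    simpa using ENNReal.tendsto_ofReal (tendsto_pow_atTop_nhds_zero_of_lt_one hρ0 hρ1)
  refine tendsto_of_tendsto_of_tendsto_of_le_of_le' tendsto_const_nhds hlim
    (Eventually.of_forall fun _ => zero_le) ?_
  filter_upwards [eventually_ge_atTop 1] with n hn
  exact measure_normSq_lt_le hv (he n hn) hη

lemma tendsto_measure_exists_fittedSS_gt [IsProbabilityMeasure P] {p : ℕ → ℕ}
    {X : ∀ n : ℕ, Ω → Fin n → Fin (p n) → ℝ} {e : ∀ n : ℕ, Ω → Fin n → ℝ} {v : ℝ≥0}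
    (hv : v ≠ 0) (hX : ∀ n, 1 ≤ n → AEMeasurable (X n) P)
    (he : ∀ n, 1 ≤ n → HasLaw (e n) (Measure.pi fun _ => gaussianReal 0 v) P)
    (hXe : ∀ n, 1 ≤ n → IndepFun (X n) (e n) P) (hp : Tendsto p atTop atTop)
    {η : ℝ} (hη : 0 < η) :
    Tendsto (fun n => P {ω | ∃ γ : Finset (Fin (p n)), γ ≠ ∅ ∧
      2 * (1 + η) * v * γ.card * Real.log (p n) <
        e n ω ⬝ᵥ (projMatrix (Matrix.of (X n ω)) γ *ᵥ e n ω)}) atTop (𝓝 0) := by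
  -- A tilt below `1` with `s (1 + η) > 1`, so that the power of `p` in the union bound is negative.
  set s : ℝ := (1 + η / 2) / (1 + η) with hs
  have hs0 : 0 < s := by positivity
  have hs1 : s < 1 := by rw [hs, div_lt_one (by linarith)]; linarith
  have hsη : 1 - s * (1 + η) = -(η / 2) := by
    rw [hs]; field_simp; ring
  have hpow : Tendsto (fun n => (p n : ℝ) ^ (1 - s * (1 + η))) atTop (𝓝 0) := by
    rw [hsη]
    exact (tendsto_rpow_neg_atTop (by linarith : 0 < η / 2)).comp
      (tendsto_natCast_atTop_atTop.comp hp)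
  have hlim : Tendsto (fun n => ENNReal.ofReal
      (Real.exp ((√(1 - s))⁻¹ * (p n : ℝ) ^ (1 - s * (1 + η))) - 1)) atTop (𝓝 0) := by
    have := ((hpow.const_mul (√(1 - s))⁻¹).rexp.sub_const 1)
    rw [mul_zero, Real.exp_zero, sub_self] at this
    simpa using ENNReal.tendsto_ofReal this
  refine tendsto_of_tendsto_of_tendsto_of_le_of_le' tendsto_const_nhds hlim
    (Eventually.of_forall fun _ => zero_le) ?_
  filter_upwards [eventually_ge_atTop 1, hp.eventually_ge_atTop 1] with n hn hpn
  exact measure_exists_fittedSS_gt_le hv (hX n hn) (he n hn) (hXe n hn) hpn hs0 hs1 η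

/-- With probability tending to one the posterior odds against the null model decay geometrically
in the size of the model, uniformly over the hyperparameters. -/
lemma exists_exceptional_odds_le [IsProbabilityMeasure P] {p : ℕ → ℕ}
    {X : ∀ n : ℕ, Ω → Fin n → Fin (p n) → ℝ} {e : ∀ n : ℕ, Ω → Fin n → ℝ} {σ₀ : ℝ≥0}
    (hσ₀ : 0 < σ₀) (hX : ∀ n, 1 ≤ n → AEMeasurable (X n) P)
    (he : ∀ n, 1 ≤ n → HasLaw (e n) (Measure.pi fun _ => gaussianReal 0 (σ₀ ^ 2)) P)
    (hXe : ∀ n, 1 ≤ n → IndepFun (X n) (e n) P) {ν : ℝ} (hν : 0 < ν)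
    {π : ∀ n : ℕ, PMF (Finset (Fin (p n)))} {C₀ : ℝ} (hC₀ : 0 < C₀)
    (hπ : ∀ n, 1 ≤ n → ∀ γ, π n γ / π n ∅ ≤ ENNReal.ofReal C₀)
    (hp : Tendsto p atTop atTop)
    (hplog : (fun n => (p n : ℝ) * Real.log (p n)) =o[atTop] fun n => (n : ℝ))
    {φlow φup : ℕ → ℝ} (hlow : ∀ n, 1 ≤ n → 0 < φlow n) {C₃ δ : ℝ} (hC₃ : 0 < C₃)
    (heig : ∀ n, 1 ≤ n → ∀ᵐ ω ∂P, ∀ γ : Finset (Fin (p n)), ∅ ⊆ γ → γ ≠ ∅ →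
      C₃ * (n : ℝ) ^ (-δ) ≤ minEigenvalue (residualGram (Matrix.of (X n ω)) ∅ γ))
    {q : ℝ} (hq : 1 < q) :
    ∃ B : ℕ → Set Ω, Tendsto (fun n => P (B n)) atTop (𝓝 0) ∧
      ∀ᶠ n in atTop, ∀ ω ∉ B n, ∀ c ∈ hyperBox (p n) (φlow n) (φup n),
        ∑ γ, posterior (π n) ν c (Matrix.of (X n ω)) (e n ω) γ = 1 ∧
        ∀ γ, γ ≠ ∅ → posterior (π n) ν c (Matrix.of (X n ω)) (e n ω) γ /
            posterior (π n) ν c (Matrix.of (X n ω)) (e n ω) ∅ ≤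
          ENNReal.ofReal (C₀ * ((p n : ℝ) ^ q *
            (√(C₃ * ((n : ℝ) ^ (1 - δ) * φlow n)))⁻¹) ^ γ.card) := by
  set v : ℝ≥0 := σ₀ ^ 2 with hvdef
  have hv : v ≠ 0 := (pow_pos hσ₀ 2).ne'
  have hv' : (0 : ℝ) < v := by positivity
  -- Half the threshold below which `1 + η < q (1 - 2η)`; the slack absorbs the factor `1 + ν / n`.
  set η : ℝ := (q - 1) / (2 * (1 + 2 * q)) with hηdef
  have hη : 0 < η := div_pos (by linarith) (by linarith)
  have hη4 : 4 * η < 1 := by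
    have : η < 1 / 4 := by rw [hηdef, div_lt_div_iff₀ (by linarith) (by norm_num)]; linarith
    linarith
  have hηq : 1 + η < q * (1 - 2 * η) := by
    have : η * (2 * (1 + 2 * q)) = q - 1 := div_mul_cancel₀ _ (by linarith)
    nlinarith
  set B₁ : ℕ → Set Ω := fun n => {ω | ¬ ∀ γ : Finset (Fin (p n)), ∅ ⊆ γ → γ ≠ ∅ →
      C₃ * (n : ℝ) ^ (-δ) ≤ minEigenvalue (residualGram (Matrix.of (X n ω)) ∅ γ)}
  set B₂ : ℕ → Set Ω := fun n => {ω | e n ω ⬝ᵥ e n ω < (1 - η) * (n * v)}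
  set B₃ : ℕ → Set Ω := fun n => {ω | ∃ γ : Finset (Fin (p n)), γ ≠ ∅ ∧
      2 * (1 + η) * v * γ.card * Real.log (p n) <
        e n ω ⬝ᵥ (projMatrix (Matrix.of (X n ω)) γ *ᵥ e n ω)}
  have hB₁ : Tendsto (fun n => P (B₁ n)) atTop (𝓝 0) := by
    refine tendsto_const_nhds.congr' ?_
    filter_upwards [eventually_ge_atTop 1] with n hn
    exact (ae_iff.mp (heig n hn)).symm
  have hB₂ : Tendsto (fun n => P (B₂ n)) atTop (𝓝 0) :=
    tendsto_measure_normSq_lt hv he hη (by linarith)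
  have hB₃ : Tendsto (fun n => P (B₃ n)) atTop (𝓝 0) :=
    tendsto_measure_exists_fittedSS_gt hv hX he hXe hp hη
  refine ⟨fun n => B₁ n ∪ B₂ n ∪ B₃ n, ?_, ?_⟩
  · have hsum := (hB₁.add hB₂).add hB₃
    rw [add_zero, add_zero] at hsum
    refine tendsto_of_tendsto_of_tendsto_of_le_of_le tendsto_const_nhds hsum
      (fun _ => zero_le) fun n => ?_
    exact (measure_union_le _ _).trans (add_le_add_left (measure_union_le _ _) _)
  have hνn : ∀ᶠ n : ℕ in atTop, (1 + ν / n) * (1 + η) ≤ q * (1 - 2 * η) := by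
    have h1 : Tendsto (fun n : ℕ => (1 + ν / n) * (1 + η)) atTop (𝓝 ((1 + 0) * (1 + η))) :=
      ((tendsto_const_div_atTop_nhds_zero_nat ν).const_add 1).mul_const _
    rw [add_zero, one_mul] at h1
    exact (h1.eventually_lt_const hηq).mono fun n => le_of_lt
  have hpl : ∀ᶠ n : ℕ in atTop, 2 * (1 + η) * (p n * Real.log (p n)) ≤ η * n := by
    filter_upwards [hplog.bound (c := η / (2 * (1 + η))) (by positivity)] with n hn
    have h2 := (Real.le_norm_self _).trans hn
    rw [Real.norm_of_nonneg (Nat.cast_nonneg n)] at h2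
    calc _ ≤ 2 * (1 + η) * (η / (2 * (1 + η)) * n) := by gcongr
      _ = η * n := by field_simp
  filter_upwards [hνn, hpl, eventually_ge_atTop 1, hp.eventually_ge_atTop 1]
    with n hνn hpl hn hpn ω hω c hc
  simp only [Set.mem_union, not_or] at hω
  obtain ⟨⟨h1, h2⟩, h3⟩ := hω
  have hn' : (0 : ℝ) < n := by exact_mod_cast hn
  have hl : ∀ γ : Finset (Fin (p n)), γ ≠ ∅ →
      C₃ * (n : ℝ) ^ (-δ) ≤ minEigenvalue (residualGram (Matrix.of (X n ω)) ∅ γ) :=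
    fun γ hγ => not_not.mp h1 γ (Finset.empty_subset γ) hγ
  have hr : 0 < (n : ℝ) * (C₃ * (n : ℝ) ^ (-δ)) := by positivity
  have hgram : ∀ (γ : Finset (Fin (p n))) (w : {j // j ∈ γ} → ℝ),
      (n : ℝ) * (C₃ * (n : ℝ) ^ (-δ)) * (w ⬝ᵥ w) ≤
        (cols (Matrix.of (X n ω)) γ *ᵥ w) ⬝ᵥ (cols (Matrix.of (X n ω)) γ *ᵥ w) := by
    intro γ w
    -- The eigenvalue condition excludes `∅`, where both sides vanish.
    rcases eq_or_ne γ ∅ with rfl | hγ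
    · have : w = 0 := funext fun j => absurd j.2 (Finset.notMem_empty _)
      simp [this]
    · exact le_gram_of_minEigenvalue hn _ γ (hl γ hγ) w
  have hra : (n : ℝ) * (C₃ * (n : ℝ) ^ (-δ)) * φlow n = C₃ * ((n : ℝ) ^ (1 - δ) * φlow n) := by
    rw [sub_eq_add_neg 1 δ, Real.rpow_add hn', Real.rpow_one]
    ring
  have hc' : ∀ j, φlow n ≤ c j := fun j => (hc j).1
  refine ⟨(posterior_odds_le hν hC₀ (hπ n hn) _ (hlow n hn) hc' hr hgram).1, fun γ hγ => ?_⟩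
  rw [← hra]
  refine posterior_odds_le_of_event hν hC₀ (hπ n hn) _ (hlow n hn) hc' hr hgram hn hpn hv' hη
    (by linarith) hpl hνn (not_lt.mp h2) ?_
  by_contra hcon
  exact h3 ⟨γ, hγ, not_le.mp hcon⟩

lemma tendsto_rpow_mul_sqrt_inv {p : ℕ → ℕ} {N : ℕ → ℝ} (hN : Tendsto N atTop atTop) {C a : ℝ}
    (h : (fun n => (p n : ℝ) ^ a) =o[atTop] N) :
    Tendsto (fun n => (p n : ℝ) ^ (a / 2) * (√(C * N n))⁻¹) atTop (𝓝 0) := by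
  have h1 := (h.tendsto_div_nhds_zero.div_const C).sqrt
  rw [zero_div, Real.sqrt_zero] at h1
  refine h1.congr' ?_
  filter_upwards [hN.eventually_gt_atTop 0] with n hn
  rw [div_div, mul_comm (N n) C, Real.sqrt_div (by positivity), div_eq_mul_inv,
    Real.sqrt_eq_rpow, ← Real.rpow_mul (Nat.cast_nonneg _)]
  congr 2
  ring

end Limits

/-! ### From geometric odds to the three posterior quantities. -/

section NullModel

variable {n p : ℕ} {π : PMF (Finset (Fin p))} {ν a b : ℝ} {X : Matrix (Fin n) (Fin p) ℝ}
  {y : Fin n → ℝ} {C₀ x : ℝ}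

lemma supOdds_le (hC₀ : 0 < C₀) (hx0 : 0 ≤ x) (hx1 : x ≤ 1)
    (h : ∀ c ∈ hyperBox p a b, ∀ γ, γ ≠ ∅ →
      posterior π ν c X y γ / posterior π ν c X y ∅ ≤ ENNReal.ofReal (C₀ * x ^ γ.card)) :
    supOdds π ν a b ∅ X y ≤ ENNReal.ofReal (C₀ * x) := by
  refine iSup₂_le fun c hc => iSup₂_le fun γ hγ => (h c hc γ hγ).trans ?_
  refine ENNReal.ofReal_le_ofReal ?_
  gcongr
  exact pow_le_of_le_one hx0 hx1 (Finset.card_ne_zero.mpr (Finset.nonempty_iff_ne_empty.mpr hγ))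

lemma supWrong_le (hC₀ : 0 < C₀) (hx0 : 0 ≤ x)
    (hsum : ∀ c ∈ hyperBox p a b, ∑ γ, posterior π ν c X y γ = 1)
    (h : ∀ c ∈ hyperBox p a b, ∀ γ, γ ≠ ∅ →
      posterior π ν c X y γ / posterior π ν c X y ∅ ≤ ENNReal.ofReal (C₀ * x ^ γ.card)) :
    supWrong π ν a b ∅ X y ≤ ENNReal.ofReal (C₀ * (Real.exp (p * x) - 1)) := by
  refine iSup₂_le fun c hc => ?_
  -- Hence each posterior probability is at most the corresponding odds.
  have hle : posterior π ν c X y ∅ ≤ 1 := by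
    rw [← hsum c hc]
    exact Finset.single_le_sum (fun _ _ => zero_le) (Finset.mem_univ _)
  calc ∑ γ ∈ Finset.univ.erase ∅, posterior π ν c X y γ
      ≤ ∑ γ ∈ (Finset.univ : Finset (Finset (Fin p))).erase ∅,
          ENNReal.ofReal (C₀ * x ^ γ.card) := by
        refine Finset.sum_le_sum fun γ hγ => ?_
        refine le_trans ?_ (h c hc γ (Finset.ne_of_mem_erase hγ))
        calc posterior π ν c X y γ = posterior π ν c X y γ / 1 := (div_one _).symm
          _ ≤ _ := ENNReal.div_le_div_left hle _
    _ ≤ _ := by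
        rw [← ENNReal.ofReal_sum_of_nonneg fun γ _ => by positivity, ← Finset.mul_sum]
        refine ENNReal.ofReal_le_ofReal ?_
        gcongr
        exact sum_erase_empty_pow_card_le hx0

lemma edist_infTrue_one_le (hab : a ≤ b)
    (hsum : ∀ c ∈ hyperBox p a b, ∑ γ, posterior π ν c X y γ = 1) :
    edist (infTrue π ν a b ∅ X y) 1 ≤ supWrong π ν a b ∅ X y := by
  -- The infimum over an empty box would be `⊤`.
  have hne : (fun _ => a) ∈ hyperBox p a b := fun _ => ⟨le_rfl, hab⟩
  have hle : infTrue π ν a b ∅ X y ≤ 1 := by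
    refine (iInf₂_le _ hne).trans ?_
    rw [← hsum _ hne]
    exact Finset.single_le_sum (fun _ _ => zero_le) (Finset.mem_univ _)
  refine edist_le_of_le_add (ne_top_of_le_ne_top ENNReal.one_ne_top hle) ENNReal.one_ne_top
    (hle.trans le_self_add) ?_
  rw [← tsub_le_iff_right]
  refine le_iInf₂ fun c hc => ?_
  rw [tsub_le_iff_right, ← hsum c hc, ← Finset.add_sum_erase _ _ (Finset.mem_univ ∅)]
  gcongr
  exact le_iSup₂ (f := fun c (_ : c ∈ hyperBox p a b) =>
    ∑ γ ∈ Finset.univ.erase ∅, posterior π ν c X y γ) c hc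

end NullModel

end BayesSelection

/-! ### Conclusion under the two growth rates. -/

theorem mainTheorem3
    {Ω : Type*} [MeasurableSpace Ω] (P : Measure Ω) [IsProbabilityMeasure P]
    -- dimension, design matrix, errors (the response is the error vector: null true model)
    (p : ℕ → ℕ)
    (X : ∀ n : ℕ, Ω → (Fin n → Fin (p n) → ℝ))
    (ε : ∀ n : ℕ, Ω → (Fin n → ℝ))
    (σ₀ : ℝ≥0) (hσ₀ : 0 < σ₀)
    (hX : ∀ n, 1 ≤ n → AEMeasurable (X n) P)
    (hε : ∀ n, 1 ≤ n → HasLaw (ε n) (Measure.pi fun _ => gaussianReal 0 (σ₀ ^ 2)) P)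
    (hXε : ∀ n, 1 ≤ n → IndepFun (X n) (ε n) P)
    -- the Bayesian model: degrees of freedom and prior on models
    (ν : ℝ) (hν : 0 < ν)
    (π : ∀ n : ℕ, PMF (Finset (Fin (p n))))
    -- bounded prior odds
    (C₀ : ℝ) (hC₀ : 0 < C₀)
    (hπ : ∀ n, 1 ≤ n → ∀ γ, π n γ / π n ∅ ≤ ENNReal.ofReal C₀)
    -- growth of the dimension
    (hp : Tendsto p atTop atTop) (hpn : ∀ n, 1 ≤ n → p n ≤ n)
    (hplog : (fun n => (p n : ℝ) * Real.log (p n)) =o[atTop] fun n => (n : ℝ))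
    -- range of the hyperparameters
    (φlow φup : ℕ → ℝ)
    (hlow : ∀ n, 1 ≤ n → 0 < φlow n) (hlowup : ∀ n, 1 ≤ n → φlow n ≤ φup n)
    (δ₀ : ℝ) (hδ₀ : 0 < δ₀) (hup : φup =O[atTop] fun n => (n : ℝ) ^ δ₀)
    -- eigenvalue condition on the design
    (C₃ δ : ℝ) (hC₃ : 0 < C₃) (hδ : 0 ≤ δ)
    (hrate : Tendsto (fun n : ℕ => (n : ℝ) ^ (1 - δ) * φlow n) atTop atTop)
    (heig : ∀ n, 1 ≤ n → ∀ᵐ ω ∂P, ∀ γ : Finset (Fin (p n)), ∅ ⊆ γ → γ ≠ ∅ →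
      C₃ * (n : ℝ) ^ (-δ) ≤
        BayesSelection.minEigenvalue
          (BayesSelection.residualGram (Matrix.of (X n ω)) ∅ γ)) :
    ((∃ α₀ : ℝ, 2 < α₀ ∧
        (fun n => (p n : ℝ) ^ α₀) =o[atTop] fun n => (n : ℝ) ^ (1 - δ) * φlow n) →
      TendstoInMeasure P
        (fun n ω => BayesSelection.supOdds (π n) ν (φlow n) (φup n) ∅
          (Matrix.of (X n ω)) (ε n ω)) atTop (fun _ => 0)) ∧
    ((∃ α₀ : ℝ, 2 < α₀ ∧
        (fun n => (p n : ℝ) ^ (α₀ + 2)) =o[atTop] fun n => (n : ℝ) ^ (1 - δ) * φlow n) →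
      TendstoInMeasure P
        (fun n ω => BayesSelection.supWrong (π n) ν (φlow n) (φup n) ∅
          (Matrix.of (X n ω)) (ε n ω)) atTop (fun _ => 0) ∧
      TendstoInMeasure P
        (fun n ω => BayesSelection.infTrue (π n) ν (φlow n) (φup n) ∅
          (Matrix.of (X n ω)) (ε n ω)) atTop (fun _ => 1)) := by
  constructor
  · rintro ⟨α₀, hα₀, hα⟩
    obtain ⟨B, hB, hodds⟩ := BayesSelection.exists_exceptional_odds_le (φup := φup) hσ₀ hX hε hXε hν
      hC₀ hπ hp hplog hlow hC₃ heig (by linarith : 1 < α₀ / 2)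
    have hx := BayesSelection.tendsto_rpow_mul_sqrt_inv (C := C₃) hrate hα
    set x : ℕ → ℝ := fun n =>
      (p n : ℝ) ^ (α₀ / 2) * (√(C₃ * ((n : ℝ) ^ (1 - δ) * φlow n)))⁻¹ with hxdef
    have hu : Tendsto (fun n => ENNReal.ofReal (C₀ * x n)) atTop (𝓝 0) := by
      simpa using ENNReal.tendsto_ofReal (hx.const_mul C₀)
    refine BayesSelection.tendstoInMeasure_of_exceptional hB hu ?_
    filter_upwards [hodds, hx.eventually_lt_const one_pos] with n hn hx1 ω hω
    have hle := BayesSelection.supOdds_le hC₀ (by positivity) hx1.le fun c hc => (hn ω hω c hc).2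
    exact BayesSelection.edist_le_of_le_add (ne_top_of_le_ne_top ENNReal.ofReal_ne_top hle)
      ENNReal.zero_ne_top (by rwa [zero_add]) zero_le
  · rintro ⟨α₀, hα₀, hα⟩
    obtain ⟨B, hB, hodds⟩ := BayesSelection.exists_exceptional_odds_le (φup := φup) hσ₀ hX hε hXε hν
      hC₀ hπ hp hplog hlow hC₃ heig (by linarith : 1 < α₀ / 2)
    set x : ℕ → ℝ := fun n =>
      (p n : ℝ) ^ (α₀ / 2) * (√(C₃ * ((n : ℝ) ^ (1 - δ) * φlow n)))⁻¹ with hxdef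
    -- The extra `2` in the exponent becomes, after the square root, the factor `p` multiplying `x`.
    have hpx : Tendsto (fun n => (p n : ℝ) * x n) atTop (𝓝 0) := by
      refine (BayesSelection.tendsto_rpow_mul_sqrt_inv (C := C₃) hrate hα).congr' ?_
      filter_upwards [hp.eventually_ge_atTop 1] with n hn
      have hpn' : (0 : ℝ) < p n := by exact_mod_cast hn
      rw [hxdef, add_div, div_self two_ne_zero, Real.rpow_add_one hpn'.ne']
      ring
    have hu : Tendsto (fun n => ENNReal.ofReal (C₀ * (Real.exp (p n * x n) - 1))) atTop (𝓝 0) := by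
      have h1 := (hpx.rexp.sub_const 1).const_mul C₀
      rw [Real.exp_zero, sub_self, mul_zero] at h1
      simpa using ENNReal.tendsto_ofReal h1
    have hwrong : ∀ᶠ n in atTop, ∀ ω ∉ B n,
        BayesSelection.supWrong (π n) ν (φlow n) (φup n) ∅ (Matrix.of (X n ω)) (ε n ω) ≤
          ENNReal.ofReal (C₀ * (Real.exp (p n * x n) - 1)) := by
      filter_upwards [hodds] with n hn ω hω
      exact BayesSelection.supWrong_le hC₀ (by positivity) (fun c hc => (hn ω hω c hc).1)
        fun c hc => (hn ω hω c hc).2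
    constructor
    · refine BayesSelection.tendstoInMeasure_of_exceptional hB hu ?_
      filter_upwards [hwrong] with n hn ω hω
      have hle := hn ω hω
      exact BayesSelection.edist_le_of_le_add (ne_top_of_le_ne_top ENNReal.ofReal_ne_top hle)
        ENNReal.zero_ne_top (by rwa [zero_add]) zero_le
    · refine BayesSelection.tendstoInMeasure_of_exceptional hB hu ?_
      filter_upwards [hwrong, hodds, eventually_ge_atTop 1] with n hn hn' hn1 ω hω
      exact (BayesSelection.edist_infTrue_one_le (hlowup n hn1)
        fun c hc => (hn' ω hω c hc).1).trans (hn ω hω)
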